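/- Let $a,b>0$. For $j\ge 0$ let $P_j^{(\alpha,\beta)}$ be the usual Jacobi polynomial of degree $j$, let $h_j^{(\alpha,\beta)}=\int_{-1}^{1}P_j^{(\alpha,\beta)}(x)^2(1-x)^{\alpha}(1+x)^{\beta}\,dx$ for $\alpha,\beta>-1$, and for $-1<x,y<1$ put $$\varphi_j^{(4)}(x)=\frac{P_j^{(a-1,b-1)}(x)}{\sqrt{h_j^{(a-1,b-1)}}}(1-x)^{\frac a2-1}(1+x)^{\frac b2-1},\qquad S_N^{(4)}(x,y)=\sum_{j=0}^{2N}(1-x^2)\varphi_j^{(4)}(x)\varphi_j^{(4)}(y).$$ Let $K_{\mathrm{sine}}(x,y)=\dfrac{\sin(x-y)}{\pi(x-y)}$ for $x\ne y$ and $K_{\mathrm{sine}}(x,x)=\dfrac1\pi$. Then, as $N\to\infty$, $$\frac{1}{2N}S_N^{(4)}\!\left(\frac{x}{2N},\frac{y}{2N}\right)=K_{\mathrm{sine}}(x,y)+O(N^{-1}),$$ and the error term is uniform for $x$ and $y$ in compact subsets of $\mathbb{R}$. That is, for every compact $K\subset\mathbb{R}$ there are constants $C$ and $N_0$, depending only on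 $a$, $b$ and $K$, such that for all $N\ge N_0$ and all $x,y\in K$ one has $\left|\frac{1}{2N}S_N^{(4)}\left(\frac{x}{2N},\frac{y}{2N}\right)-K_{\mathrm{sine}}(x,y)\right|\le C/N$. -/

import Mathlib

noncomputable section

namespace JSE

open Polynomial in
/-- The Jacobi polynomial `P_n^{(α,β)}` in its usual normalization,
`P_n^{(α,β)}(x) = ∑_{s=0}^n binom(n+α, n-s) binom(n+β, s) ((x-1)/2)^s ((x+1)/2)^(n-s)`,
with generalized binomial coefficients. -/
def jacobiP (α β : ℝ) (n : ℕ) : ℝ[X] :=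
  ∑ s ∈ Finset.range (n + 1),
    C (Ring.choose ((n : ℝ) + α) (n - s) * Ring.choose ((n : ℝ) + β) s) *
      (C (1 / 2) * (X - 1)) ^ s * (C (1 / 2) * (X + 1)) ^ (n - s)

/-- The normalization constant
`h_n^{(α,β)} = ∫_{-1}^1 P_n^{(α,β)}(x)^2 (1-x)^α (1+x)^β dx`. -/
def jacobiH (α β : ℝ) (n : ℕ) : ℝ :=
  ∫ x in (-1 : ℝ)..1, ((jacobiP α β n).eval x) ^ 2 * (1 - x) ^ α * (1 + x) ^ β

/-- `φ_j^{(4)}(x) = P_j^{(a-1,b-1)}(x) / √(h_j^{(a-1,b-1)}) (1-x)^{a/2-1} (1+x)^{b/2-1}`,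
for `-1 < x < 1`. -/
def phi4 (a b : ℝ) (j : ℕ) (x : ℝ) : ℝ :=
  (jacobiP (a - 1) (b - 1) j).eval x / √(jacobiH (a - 1) (b - 1) j) *
    (1 - x) ^ (a / 2 - 1) * (1 + x) ^ (b / 2 - 1)

/-- `S_N^{(4)}(x,y) = ∑_{j=0}^{2N} (1-x^2) φ_j^{(4)}(x) φ_j^{(4)}(y)`. -/
def S4 (a b : ℝ) (N : ℕ) (x y : ℝ) : ℝ :=
  ∑ j ∈ Finset.range (2 * N + 1), (1 - x ^ 2) * phi4 a b j x * phi4 a b j y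

/-- The sine kernel `sin (x-y) / (π (x-y))`, with its continuous value `1/π` at `x = y`. -/
def sineKernel (x y : ℝ) : ℝ :=
  if x = y then 1 / Real.pi else Real.sin (x - y) / (Real.pi * (x - y))

end JSE

end

noncomputable section
namespace JSE
open Polynomial

/-! Put `α = a - 1`, `β = b - 1`, let `w` be the Jacobi weight and `p_n` the orthonormal
polynomials, with recurrence `x p_n = a_{n+1} p_{n+1} + b_n p_n + a_n p_{n-1}`. Up to factors equal
to `1 + O(1/N)` near the origin, the rescaled `S4` is the Christoffel–Darboux kernel of degree `n =
2N`. The argument avoids the classical asymptotics of Jacobi polynomials and uses only their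
recurrence and their first-order differential relations.

By `christoffel_darboux`, the kernel times `x - y` is `a_{n+1}` times a Wronskian-like form in the
pair `(p_{n+1}, p_n)`. At distance `O(1/n)` from the origin the differential relations say `p_{n+1}'
= n p_n + O(1)` and `p_n' = -n p_{n+1} + O(1)` (`exists_abs_derivative_orthoJ_sub_le`), so in the
variable `t = n x` the pair satisfies a rotation system up to `O(1/n)`. Then
`abs_wronskian_sub_sin_le` replaces the form by `(p_n(0)^2 + p_{n+1}(0)^2) sin (x - y)`, with an
error proportional to `|x - y|`. That factor is what permits division by `x - y`; the diagonal
follows by continuity.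

It remains to bound `p_n` near the origin and to find the amplitude. Both come from the Turán form
`D_n = p_n^2 + p_{n+1}^2 - 2 x p_n p_{n+1}`. It is exactly invariant when `a_n = 1/2` and `b_n = 0`;
since the coefficients differ from these by `O(1/n^2)`, `D_n` changes by a relative `O(1/n^2)` per
step. Hence it is bounded and converges at rate `O(1/n)`, uniformly on `[-1/2, 1/2]`. The limit is
identified weakly: `D_n w` tends to `(2/π) √(1 - x^2)` against continuous test functions
(`tendsto_integral_mul_turan`), and near the origin the uniform Cauchy estimate turns this into
`D_n(0) → 2/π` (`turan_limit_eq`). The amplitude is therefore `a_{n+1} D_n(0) = 1/π + O(1/n)`. -/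

/-- The subleading coefficient of the monic Jacobi polynomial. -/
def subCoeff (α β : ℝ) (n : ℕ) : ℝ := n * (α - β) / (2 * n + α + β)

/-- The diagonal recurrence coefficient of the monic Jacobi polynomials. -/
def recB (α β : ℝ) (n : ℕ) : ℝ := subCoeff α β n - subCoeff α β (n + 1)

/-- The off-diagonal recurrence coefficient of the monic Jacobi polynomials. -/
def recA (α β : ℝ) : ℕ → ℝ
  | 0 => 0
  | n + 1 => (1 - recB α β n ^ 2 + (2 * n + α + β - 1) * recA α β n) / (2 * n + α + β + 3)

/-- The monic Jacobi polynomials, defined by their three-term recurrence. -/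
def monicJ (α β : ℝ) : ℕ → ℝ[X]
  | 0 => 1
  | 1 => X - C (recB α β 0)
  | n + 2 => (X - C (recB α β (n + 1))) * monicJ α β (n + 1) - C (recA α β (n + 1)) * monicJ α β n

/-! ### Algebra of the recurrence coefficients and the differential relations -/

variable {α β : ℝ}

lemma subCoeff_zero : subCoeff α β 0 = 0 := by simp [subCoeff]

lemma recA_zero : recA α β 0 = 0 := rfl

lemma two_mul_add_pos (hα : -1 < α) (hβ : -1 < β) {n : ℕ} (hn : 1 ≤ n) :
    0 < 2 * (n : ℝ) + α + β := by
  have : (1 : ℝ) ≤ n := by exact_mod_cast hn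
  linarith

lemma mul_subCoeff (hα : -1 < α) (hβ : -1 < β) (n : ℕ) :
    (2 * n + α + β) * subCoeff α β n = n * (α - β) := by
  rcases Nat.eq_zero_or_pos n with rfl | hn
  · simp [subCoeff]
  · have := two_mul_add_pos hα hβ hn
    unfold subCoeff
    field_simp

lemma mul_recA_succ (hα : -1 < α) (hβ : -1 < β) (n : ℕ) :
    (2 * n + α + β + 3) * recA α β (n + 1) =
      1 - recB α β n ^ 2 + (2 * n + α + β - 1) * recA α β n := by
  have h : (0 : ℝ) ≤ n := n.cast_nonneg
  have : 0 < 2 * (n : ℝ) + α + β + 3 := by linarith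
  rw [recA]
  field_simp

lemma recB_relation (hα : -1 < α) (hβ : -1 < β) (n : ℕ) :
    (2 * n + α + β + 3) * recB α β (n + 1) - (2 * n + α + β + 1) * recB α β n =
      subCoeff α β (n + 2) - subCoeff α β n := by
  have h0 := mul_subCoeff hα hβ n
  have h1 := mul_subCoeff hα hβ (n + 1)
  have h2 := mul_subCoeff hα hβ (n + 2)
  push_cast at h1 h2
  simp only [recB, show n + 1 + 1 = n + 2 from rfl]
  linear_combination -h2 + 2 * h1 - h0

/-- The derivative of a monic Jacobi polynomial in terms of its neighbours. -/
lemma monicJ_derivative (hα : -1 < α) (hβ : -1 < β) (n : ℕ) (x : ℝ) :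
    (1 - x ^ 2) * (derivative (monicJ α β (n + 1))).eval x =
        (subCoeff α β (n + 1) - (n + 1) * x) * (monicJ α β (n + 1)).eval x +
          (2 * n + α + β + 3) * recA α β (n + 1) * (monicJ α β n).eval x ∧
      (1 - x ^ 2) * (derivative (monicJ α β n)).eval x =
        (subCoeff α β n - n * x) * (monicJ α β n).eval x +
          (2 * n + α + β + 1) *
            ((x - recB α β n) * (monicJ α β n).eval x - (monicJ α β (n + 1)).eval x) := by
  induction n with
  | zero =>
    have h := mul_recA_succ hα hβ 0
    constructor
    · simp [monicJ, recB, subCoeff_zero, recA_zero] at h ⊢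
      linear_combination -h
    · simp [monicJ, recB, subCoeff_zero]
  | succ n ih =>
    obtain ⟨h1, h2⟩ := ih
    -- Differentiating the three-term recurrence and inserting both induction hypotheses leaves a
    -- consistency condition on the coefficients, which is the recursion defining `recA`.
    have hA := mul_recA_succ hα hβ (n + 1)
    have hB := recB_relation hα hβ n
    have hb : recB α β (n + 1) = subCoeff α β (n + 1) - subCoeff α β (n + 2) := rfl
    push_cast at hA
    constructor
    · simp only [monicJ, derivative_sub, derivative_mul, derivative_X, derivative_C, eval_sub,
        eval_mul, eval_X, eval_C, eval_add, eval_one, sub_zero, zero_mul, zero_add]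
      push_cast
      linear_combination (x - recB α β (n + 1)) * h1 - recA α β (n + 1) * h2 -
        eval x (monicJ α β (n + 1)) * hA - recA α β (n + 1) * eval x (monicJ α β n) * hB -
        eval x (monicJ α β (n + 1)) * (x - recB α β (n + 1)) * hb
    -- At index `n + 1` the second relation is the first one with the recurrence substituted.
    · simp only [monicJ, eval_sub, eval_mul, eval_X, eval_C]
      push_cast
      linear_combination h1

/-- Kept free of division because for `n = 0` the factor `α + β + 1` may vanish. It serves the
asymptotics only; positivity of `recA` comes from the norms instead. -/
lemma recA_closed (hα : -1 < α) (hβ : -1 < β) (n : ℕ) :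
    (2 * ((n : ℝ) + 1) + α + β - 1) * (2 * ((n : ℝ) + 1) + α + β + 1) * (2 * ((n : ℝ) + 1) + α + β) ^ 2
        * recA α β (n + 1) =
      4 * (n + 1) * (n + 1 + α) * (n + 1 + β) * (n + 1 + α + β) := by
  induction n with
  | zero =>
    have h := mul_recA_succ hα hβ 0
    have h1 := mul_subCoeff hα hβ 1
    simp [recA_zero, recB, subCoeff_zero] at h h1 ⊢
    linear_combination (α + β + 1) * (α + β + 2) ^ 2 * h -
      (α + β + 1) * ((α + β + 2) * subCoeff α β 1 + (α - β)) * h1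
  | succ n ih =>
    have h := mul_recA_succ hα hβ (n + 1)
    have h1 := mul_subCoeff hα hβ (n + 1)
    have h2 := mul_subCoeff hα hβ (n + 2)
    have hm := two_mul_add_pos hα hβ (n := n + 1) (by omega)
    push_cast at h h1 h2 hm ⊢
    have hb : (2 * ((n : ℝ) + 1) + α + β) * (2 * ((n : ℝ) + 2) + α + β) * recB α β (n + 1) =
        -(α + β) * (α - β) := by
      simp only [recB]
      linear_combination (2 * ((n : ℝ) + 2) + α + β) * h1 - (2 * ((n : ℝ) + 1) + α + β) * h2
    generalize recB α β (n + 1) = b at *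
    generalize recA α β (n + 1) = A1 at *
    generalize recA α β (n + 1 + 1) = A2 at *
    obtain ⟨m, hmd⟩ : ∃ m, m = 2 * ((n : ℝ) + 1) + α + β := ⟨_, rfl⟩
    rw [← hmd] at hm hb
    have hm2 : m ^ 2 ≠ 0 := by positivity
    apply mul_left_cancel₀ hm2
    generalize (n : ℝ) = k at *
    obtain rfl : k = (m - 2 - α - β) / 2 := by rw [hmd]; ring
    linear_combination m ^ 2 * (m + 1) * (m + 2) ^ 2 * h + (m + 2) ^ 2 * ih -
      (m + 1) * (m * (m + 2) * b - (α + β) * (α - β)) * hb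

/-! ### Integration against the Jacobi weight -/

/-- The Jacobi weight on `(-1, 1)`. -/
def weight (α β x : ℝ) : ℝ := (1 - x) ^ α * (1 + x) ^ β

lemma weight_nonneg {x : ℝ} (hx : x ∈ Set.Icc (-1 : ℝ) 1) : 0 ≤ weight α β x :=
  mul_nonneg (Real.rpow_nonneg (by linarith [hx.2]) _) (Real.rpow_nonneg (by linarith [hx.1]) _)

lemma weight_pos {x : ℝ} (hx : x ∈ Set.Ioo (-1 : ℝ) 1) : 0 < weight α β x :=
  mul_pos (Real.rpow_pos_of_pos (by linarith [hx.2]) _) (Real.rpow_pos_of_pos (by linarith [hx.1]) _)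

lemma continuousOn_weight : ContinuousOn (weight α β) (Set.Ioo (-1 : ℝ) 1) := by
  refine ContinuousOn.mul ?_ ?_
  · exact ContinuousOn.rpow_const (by fun_prop) fun x hx => Or.inl (by linarith [hx.2])
  · exact ContinuousOn.rpow_const (by fun_prop) fun x hx => Or.inl (by linarith [hx.1])

lemma intervalIntegrable_weight (hα : -1 < α) (hβ : -1 < β) :
    IntervalIntegrable (weight α β) MeasureTheory.volume (-1) 1 := by
  have h1 : IntervalIntegrable (fun x : ℝ => (1 + x) ^ β) MeasureTheory.volume (-1) 0 := by
    have := (intervalIntegral.intervalIntegrable_rpow' hβ (a := 0) (b := 1)).comp_add_left 1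
    simpa using this
  have h2 : IntervalIntegrable (fun x : ℝ => (1 - x) ^ α) MeasureTheory.volume 0 1 := by
    have := (intervalIntegral.intervalIntegrable_rpow' hα (a := 1) (b := 0)).comp_sub_left 1
    simpa using this
  have h3 : IntervalIntegrable (weight α β) MeasureTheory.volume (-1) 0 := by
    refine h1.continuousOn_mul ?_
    rw [Set.uIcc_of_le (by norm_num)]
    exact ContinuousOn.rpow_const (by fun_prop) fun x hx => Or.inl (by linarith [hx.2])
  have h4 : IntervalIntegrable (weight α β) MeasureTheory.volume 0 1 := by
    refine h2.mul_continuousOn ?_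
    rw [Set.uIcc_of_le (by norm_num)]
    exact ContinuousOn.rpow_const (by fun_prop) fun x hx => Or.inl (by linarith [hx.1])
  exact h3.trans h4

lemma intervalIntegrable_mul_weight (hα : -1 < α) (hβ : -1 < β) {f : ℝ → ℝ}
    (hf : Continuous f) :
    IntervalIntegrable (fun x => f x * weight α β x) MeasureTheory.volume (-1) 1 :=
  (intervalIntegrable_weight hα hβ).continuousOn_mul hf.continuousOn

/-- Integration of a polynomial against the Jacobi weight. -/
def wInt (α β : ℝ) (f : ℝ[X]) : ℝ := ∫ x in (-1 : ℝ)..1, f.eval x * weight α β x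

lemma wInt_add (hα : -1 < α) (hβ : -1 < β) (f g : ℝ[X]) :
    wInt α β (f + g) = wInt α β f + wInt α β g := by
  unfold wInt
  rw [← intervalIntegral.integral_add (intervalIntegrable_mul_weight hα hβ f.continuous)
    (intervalIntegrable_mul_weight hα hβ g.continuous)]
  simp only [eval_add, add_mul]

lemma wInt_C_mul (c : ℝ) (f : ℝ[X]) : wInt α β (C c * f) = c * wInt α β f := by
  unfold wInt
  rw [← intervalIntegral.integral_const_mul]
  simp only [eval_mul, eval_C, mul_assoc]

lemma wInt_sub (hα : -1 < α) (hβ : -1 < β) (f g : ℝ[X]) :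
    wInt α β (f - g) = wInt α β f - wInt α β g := by
  have := wInt_add hα hβ (f - g) g
  rw [sub_add_cancel] at this
  linarith

lemma wInt_zero : wInt α β 0 = 0 := by simp [wInt]

lemma wInt_congr {f g : ℝ[X]} (h : ∀ x, f.eval x = g.eval x) : wInt α β f = wInt α β g := by
  rw [Polynomial.funext h]

/-- Off the finitely many roots of `f` the integrand is strictly positive on the open interval. -/
lemma wInt_mul_self_pos (hα : -1 < α) (hβ : -1 < β) {f : ℝ[X]} (hf : f ≠ 0) :
    0 < wInt α β (f * f) := by
  unfold wInt
  rw [intervalIntegral.integral_pos_iff_support_of_nonneg_ae']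
  · refine ⟨by norm_num, ?_⟩
    have hsub : Set.Ioo (-1 : ℝ) 1 \ (f.roots.toFinset : Set ℝ) ⊆
        Function.support (fun x => (f * f).eval x * weight α β x) ∩ Set.Ioc (-1) 1 := by
      rintro x ⟨hx, hr⟩
      refine ⟨?_, Set.Ioo_subset_Ioc_self hx⟩
      simp only [Finset.mem_coe, Multiset.mem_toFinset, mem_roots', not_and, IsRoot] at hr
      have := hr hf
      simp [this, (weight_pos hx).ne']
    refine lt_of_lt_of_le ?_ (MeasureTheory.measure_mono hsub)
    rw [MeasureTheory.measure_sdiff_null (f.roots.toFinset.finite_toSet.measure_zero _)]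
    simp
  · rw [Set.uIoc_of_le (by norm_num)]
    filter_upwards [MeasureTheory.self_mem_ae_restrict measurableSet_Ioc] with x hx
    rw [eval_mul]
    exact mul_nonneg (mul_self_nonneg _) (weight_nonneg (Set.Ioc_subset_Icc_self hx))
  · exact intervalIntegrable_mul_weight hα hβ (f * f).continuous

/-- Integration by parts against the Jacobi weight. -/
lemma wInt_derivative (hα : -1 < α) (hβ : -1 < β) (f : ℝ[X]) :
    wInt α β ((1 - X ^ 2) * derivative f + (C (β - α) - C (α + β + 2) * X) * f) = 0 := by
  unfold wInt
  have hα1 : 0 < α + 1 := by linarith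
  have hβ1 : 0 < β + 1 := by linarith
  -- Pearson's equation: the derivative of `(1 - x)^(α+1) (1 + x)^(β+1)` is `β - α - (α + β + 2) x`
  -- times the weight. The raised exponents are positive, so the boundary terms vanish.
  have hd : ∀ x ∈ Set.Ioo (-1 : ℝ) 1,
      HasDerivAt (fun x => (1 - x) ^ (α + 1) * (1 + x) ^ (β + 1) * f.eval x)
        (((1 - X ^ 2) * derivative f + (C (β - α) - C (α + β + 2) * X) * f).eval x *
          weight α β x) x := by
    intro x hx
    have h1 : 0 < 1 - x := by linarith [hx.2]
    have h2 : 0 < 1 + x := by linarith [hx.1]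
    have e1 := ((hasDerivAt_id x).const_sub 1).rpow_const (p := α + 1) (Or.inl h1.ne')
    have e2 := ((hasDerivAt_id x).const_add 1).rpow_const (p := β + 1) (Or.inl h2.ne')
    have e : HasDerivAt (fun x => (1 - x) ^ (α + 1) * (1 + x) ^ (β + 1) * f.eval x) _ x :=
      (e1.mul e2).mul (f.hasDerivAt x)
    refine e.congr_deriv ?_
    simp only [id, add_sub_cancel_right, Pi.mul_apply]
    rw [Real.rpow_add_one h1.ne', Real.rpow_add_one h2.ne', weight]
    simp
    ring
  have hc : ContinuousOn (fun x => (1 - x) ^ (α + 1) * (1 + x) ^ (β + 1) * f.eval x)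
      (Set.Icc (-1 : ℝ) 1) := by
    refine Continuous.continuousOn (Continuous.mul (Continuous.mul ?_ ?_) f.continuous)
    · exact Continuous.rpow_const (by fun_prop) fun x => Or.inr hα1.le
    · exact Continuous.rpow_const (by fun_prop) fun x => Or.inr hβ1.le
  rw [intervalIntegral.integral_eq_sub_of_hasDerivAt_of_le (by norm_num) hc hd
    (intervalIntegrable_mul_weight hα hβ (Polynomial.continuous _))]
  simp [Real.zero_rpow hα1.ne', Real.zero_rpow hβ1.ne']

/-! ### Orthogonality of the monic polynomials -/

lemma eval_monicJ_add_two (n : ℕ) (x : ℝ) : (monicJ α β (n + 2)).eval x =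
    (x - recB α β (n + 1)) * (monicJ α β (n + 1)).eval x -
      recA α β (n + 1) * (monicJ α β n).eval x := by
  simp [monicJ]

/-- Integration by parts applied to one monic polynomial, expanded by its differential relation and
the recurrence, gives a linear relation among three consecutive integrals in which the newest one
has a nonzero coefficient. -/
lemma wInt_monicJ_succ (hα : -1 < α) (hβ : -1 < β) (n : ℕ) : wInt α β (monicJ α β (n + 1)) = 0 := by
  induction n using Nat.strong_induction_on with
  | _ n ih =>
  match n with
  | 0 =>
    have h := wInt_derivative hα hβ 1
    have hb := mul_subCoeff hα hβ 1
    have : wInt α β ((1 - X ^ 2) * derivative 1 + (C (β - α) - C (α + β + 2) * X) * 1) =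
        wInt α β (C (-(α + β + 2)) * monicJ α β (0 + 1)) := by
      apply wInt_congr
      intro x
      simp [monicJ, recB, subCoeff_zero] at hb ⊢
      linear_combination hb
    rw [this, wInt_C_mul] at h
    rcases mul_eq_zero.1 h with h | h
    · linarith
    · exact h
  | n + 1 =>
    have h := wInt_derivative hα hβ (monicJ α β (n + 1))
    have hs := fun x => (monicJ_derivative hα hβ n x).1
    have : wInt α β ((1 - X ^ 2) * derivative (monicJ α β (n + 1)) +
          (C (β - α) - C (α + β + 2) * X) * monicJ α β (n + 1)) =
        wInt α β (C (-(n + 1 + α + β + 2)) * monicJ α β (n + 1 + 1) +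
          C (subCoeff α β (n + 1) + β - α - (n + 1 + α + β + 2) * recB α β (n + 1)) *
            monicJ α β (n + 1) + C (n * recA α β (n + 1)) * monicJ α β n) := by
      apply wInt_congr
      intro x
      have := hs x
      simp only [eval_add, eval_mul, eval_C, eval_sub, eval_X, eval_one, eval_pow,
        eval_monicJ_add_two]
      linear_combination this
    rw [this, wInt_add hα hβ, wInt_add hα hβ, wInt_C_mul, wInt_C_mul, wInt_C_mul,
      ih n (by omega)] at h
    -- The integral of `monicJ α β 0` is not zero, but for `n = 0` its coefficient is.
    have h0 : (n : ℝ) * recA α β (n + 1) * wInt α β (monicJ α β n) = 0 := by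
      rcases n with _ | n
      · simp
      · rw [ih n (by omega), mul_zero]
    have hn : (0 : ℝ) ≤ n := n.cast_nonneg
    have h1 : (-((n : ℝ) + 1 + α + β + 2)) * wInt α β (monicJ α β (n + 1 + 1)) = 0 := by
      linarith
    rcases mul_eq_zero.1 h1 with h | h
    · linarith
    · exact h

/-- The recurrence trades one power of `X` for a shift of the index by at most one, so everything
reduces to the case `k = 0`. -/
lemma wInt_X_pow_mul_monicJ (hα : -1 < α) (hβ : -1 < β) (k n : ℕ) (hkn : k < n) :
    wInt α β (X ^ k * monicJ α β n) = 0 := by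
  induction k generalizing n with
  | zero =>
    obtain ⟨n, rfl⟩ := Nat.exists_eq_succ_of_ne_zero (by omega : n ≠ 0)
    simpa using wInt_monicJ_succ hα hβ n
  | succ k ih =>
    obtain ⟨n, rfl⟩ := Nat.exists_eq_add_of_le' (by omega : 1 ≤ n)
    have : wInt α β (X ^ (k + 1) * monicJ α β (n + 1)) =
        wInt α β (X ^ k * monicJ α β (n + 2) +
          C (recB α β (n + 1)) * (X ^ k * monicJ α β (n + 1)) +
          C (recA α β (n + 1)) * (X ^ k * monicJ α β n)) := by
      apply wInt_congr
      intro x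
      simp only [eval_add, eval_mul, eval_C, eval_X, eval_pow, eval_monicJ_add_two]
      ring
    rw [this, wInt_add hα hβ, wInt_add hα hβ, wInt_C_mul, wInt_C_mul, ih _ (by omega),
      ih _ (by omega), ih _ (by omega)]
    simp

lemma wInt_mul_eq_zero_of_natDegree_lt (hα : -1 < α) (hβ : -1 < β) (q : ℝ[X]) (n : ℕ)
    (hq : ∀ k < n, wInt α β (X ^ k * q) = 0) (f : ℝ[X]) (hf : f.degree < n) :
    wInt α β (f * q) = 0 := by
  have key : ∀ s : Finset ℕ, (∀ k ∈ s, k < n) →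
      wInt α β ((∑ k ∈ s, C (f.coeff k) * X ^ k) * q) = 0 := by
    intro s
    induction s using Finset.induction_on with
    | empty => intro; simp [wInt_zero]
    | insert k s hk ih =>
      intro h
      rw [Finset.sum_insert hk, add_mul, wInt_add hα hβ, mul_assoc, wInt_C_mul,
        hq k (h k (Finset.mem_insert_self _ _)),
        ih fun j hj => h j (Finset.mem_insert_of_mem hj)]
      simp
  have := key f.support fun k hk => by
    have := le_degree_of_mem_supp k hk
    exact_mod_cast this.trans_lt hf
  rwa [← f.as_sum_support_C_mul_X_pow] at this

lemma monicJ_monic (n : ℕ) : (monicJ α β n).Monic ∧ (monicJ α β n).natDegree = n := by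
  induction n using Nat.strong_induction_on with
  | _ n ih =>
  match n with
  | 0 => simp [monicJ]
  | 1 => exact ⟨monic_X_sub_C _, natDegree_X_sub_C _⟩
  | n + 2 =>
    obtain ⟨m1, d1⟩ := ih (n + 1) (by omega)
    obtain ⟨m0, d0⟩ := ih n (by omega)
    have hm : ((X - C (recB α β (n + 1))) * monicJ α β (n + 1)).Monic := (monic_X_sub_C _).mul m1
    have hd : ((X - C (recB α β (n + 1))) * monicJ α β (n + 1)).natDegree = n + 2 := by
      rw [(monic_X_sub_C _).natDegree_mul m1, natDegree_X_sub_C, d1]; ring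
    have hlt : (C (recA α β (n + 1)) * monicJ α β n).degree <
        ((X - C (recB α β (n + 1))) * monicJ α β (n + 1)).degree := by
      rw [degree_eq_natDegree hm.ne_zero, hd]
      exact (degree_le_of_natDegree_le ((natDegree_C_mul_le _ _).trans d0.le)).trans_lt
        (by exact_mod_cast (by omega : n < n + 2))
    refine ⟨hm.sub_of_left hlt, ?_⟩
    rw [monicJ, natDegree_eq_of_degree_eq (degree_sub_eq_left_of_degree_lt hlt), hd]

lemma monicJ_degree (n : ℕ) : (monicJ α β n).degree = n := by
  rw [degree_eq_natDegree (monicJ_monic n).1.ne_zero, (monicJ_monic n).2]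

lemma wInt_monicJ_mul_of_lt (hα : -1 < α) (hβ : -1 < β) {m n : ℕ} (h : m < n) :
    wInt α β (monicJ α β m * monicJ α β n) = 0 :=
  wInt_mul_eq_zero_of_natDegree_lt hα hβ _ n (fun k hk => wInt_X_pow_mul_monicJ hα hβ k n hk) _
    (by rw [monicJ_degree]; exact_mod_cast h)

/-- The squared norm of the monic Jacobi polynomial. -/
def normSq (α β : ℝ) (n : ℕ) : ℝ := wInt α β (monicJ α β n * monicJ α β n)

lemma normSq_pos (hα : -1 < α) (hβ : -1 < β) (n : ℕ) : 0 < normSq α β n :=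
  wInt_mul_self_pos hα hβ (monicJ_monic n).1.ne_zero

lemma eval_X_mul_monicJ (n : ℕ) (x : ℝ) : x * (monicJ α β n).eval x =
    (monicJ α β (n + 1)).eval x + recB α β n * (monicJ α β n).eval x +
      recA α β n * (monicJ α β (n - 1)).eval x := by
  rcases n with _ | n
  · simp [monicJ, recA]
  · rw [eval_monicJ_add_two]
    simp only [Nat.add_sub_cancel]
    ring

/-- The integral of `x π_n π_{n+1}` is computed twice, expanding `x π_n` and then `x π_{n+1}`, where
`π_n` is the monic polynomial. -/
lemma normSq_succ (hα : -1 < α) (hβ : -1 < β) (n : ℕ) :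
    normSq α β (n + 1) = recA α β (n + 1) * normSq α β n := by
  have h1 : wInt α β (X * monicJ α β n * monicJ α β (n + 1)) = normSq α β (n + 1) := by
    have : wInt α β (X * monicJ α β n * monicJ α β (n + 1)) =
        wInt α β (monicJ α β (n + 1) * monicJ α β (n + 1) +
          C (recB α β n) * (monicJ α β n * monicJ α β (n + 1)) +
          C (recA α β n) * (monicJ α β (n - 1) * monicJ α β (n + 1))) := by
      apply wInt_congr
      intro x
      simp only [eval_add, eval_mul, eval_C, eval_X]
      linear_combination (monicJ α β (n + 1)).eval x * eval_X_mul_monicJ (α := α) (β := β) n x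
    rw [this, wInt_add hα hβ, wInt_add hα hβ, wInt_C_mul, wInt_C_mul,
      wInt_monicJ_mul_of_lt hα hβ (by omega : n < n + 1),
      wInt_monicJ_mul_of_lt hα hβ (by omega : n - 1 < n + 1), normSq]
    ring
  have h2 : wInt α β (X * monicJ α β n * monicJ α β (n + 1)) = recA α β (n + 1) * normSq α β n := by
    have : wInt α β (X * monicJ α β n * monicJ α β (n + 1)) =
        wInt α β (monicJ α β n * monicJ α β (n + 2) +
          C (recB α β (n + 1)) * (monicJ α β n * monicJ α β (n + 1)) +
          C (recA α β (n + 1)) * (monicJ α β n * monicJ α β n)) := by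
      apply wInt_congr
      intro x
      simp only [eval_add, eval_mul, eval_C, eval_X]
      rw [eval_monicJ_add_two]
      ring
    rw [this, wInt_add hα hβ, wInt_add hα hβ, wInt_C_mul, wInt_C_mul,
      wInt_monicJ_mul_of_lt hα hβ (by omega : n < n + 1),
      wInt_monicJ_mul_of_lt hα hβ (by omega : n < n + 2), normSq]
    ring
  rw [← h1, h2]

lemma recA_succ_pos (hα : -1 < α) (hβ : -1 < β) (n : ℕ) : 0 < recA α β (n + 1) := by
  have h := normSq_succ hα hβ n
  have h1 := normSq_pos hα hβ n
  have h2 := normSq_pos hα hβ (n + 1)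
  rw [h] at h2
  exact pos_of_mul_pos_left h2 h1.le

/-! ### The Jacobi polynomials are proportional to the monic ones -/

lemma sub_mul_choose (r : ℝ) (k : ℕ) :
    (r - k) * Ring.choose r k = (k + 1) * Ring.choose r (k + 1) := by
  rw [Ring.choose_eq_smul, Ring.choose_eq_smul, descPochhammer_succ_right, Nat.factorial_succ]
  simp only [smul_eq_mul, smeval_mul, smeval_sub, smeval_X, smeval_natCast]
  have h1 : ((k.factorial : ℕ) : ℝ) ≠ 0 := by positivity
  have h2 : (k : ℝ) + 1 ≠ 0 := by positivity
  push_cast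
  field_simp
  simp
  ring

lemma eval_jacobiP (n : ℕ) (x : ℝ) : (jacobiP α β n).eval x =
    ∑ s ∈ Finset.range (n + 1), Ring.choose ((n : ℝ) + α) (n - s) * Ring.choose ((n : ℝ) + β) s *
      ((x - 1) / 2) ^ s * ((x + 1) / 2) ^ (n - s) := by
  simp [jacobiP, eval_finsetSum, div_eq_inv_mul]

lemma natDegree_jacobiP_le (n : ℕ) : (jacobiP α β n).natDegree ≤ n := by
  refine natDegree_sum_le_of_forall_le _ _ fun s hs => ?_
  have hs : s ≤ n := Nat.lt_succ_iff.1 (Finset.mem_range.1 hs)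
  have h1 : (C (1 / 2 : ℝ) * (X - 1)).natDegree ≤ 1 := by
    refine (natDegree_C_mul_le _ _).trans ?_
    rw [← C_1]; exact (natDegree_X_sub_C _).le
  have h2 : (C (1 / 2 : ℝ) * (X + 1)).natDegree ≤ 1 := by
    refine (natDegree_C_mul_le _ _).trans ?_
    rw [← C_1]; exact (natDegree_X_add_C _).le
  calc _ ≤ s * 1 + (n - s) * 1 := by
        refine natDegree_mul_le_of_le ((natDegree_C_mul_le _ _).trans ?_) ?_
        · exact natDegree_pow_le_of_le s h1
        · exact natDegree_pow_le_of_le (n - s) h2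
    _ = n := by omega

/-- The value at `1` is the binomial coefficient of `n + α` over `n`, which is positive for `α >
-1`. -/
lemma jacobiP_ne_zero (hα : -1 < α) (n : ℕ) : jacobiP α β n ≠ 0 := by
  have hpos : ∀ k : ℕ, k ≤ n → 0 < Ring.choose ((n : ℝ) + α) k := by
    intro k
    induction k with
    | zero => simp
    | succ k ih =>
      intro hk
      have h1 := ih (by omega)
      have h2 := sub_mul_choose ((n : ℝ) + α) k
      have hk' : (k : ℝ) + 1 ≤ n := by exact_mod_cast hk
      have : 0 < ((n : ℝ) + α - k) := by linarith
      have h3 : 0 < ((k : ℝ) + 1) * Ring.choose ((n : ℝ) + α) (k + 1) := h2 ▸ mul_pos this h1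
      exact pos_of_mul_pos_right h3 (by positivity)
  intro h
  have h1 : (jacobiP α β n).eval 1 = Ring.choose ((n : ℝ) + α) n := by
    rw [eval_jacobiP, Finset.sum_eq_single 0]
    · simp
    · intro s _ hs
      simp [hs]
    · simp
  rw [h, eval_zero] at h1
  exact (hpos n le_rfl).ne h1

/-- One step of Rodrigues' formula, with the weight divided out. In `u = (x - 1)/2`, `v = (x + 1)/2`
the summand of index `s` feeds the terms `s` and `s + 1` of the target, and the weights `n + 1 - s`
and `s` received by each term add up to `n + 1`. -/
lemma jacobiP_raise (n : ℕ) (x : ℝ) :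
    (1 - x ^ 2) * (derivative (jacobiP (α + 1) (β + 1) n)).eval x +
        (β - α - (α + β + 2) * x) * (jacobiP (α + 1) (β + 1) n).eval x =
      -2 * (n + 1) * (jacobiP α β (n + 1)).eval x := by
  set u : ℝ := (x - 1) / 2 with hu
  set v : ℝ := (x + 1) / 2 with hv
  set e : ℕ → ℝ := fun s => Ring.choose ((n : ℝ) + 1 + α) (n + 1 - s) *
    Ring.choose ((n : ℝ) + 1 + β) s * u ^ s * v ^ (n + 1 - s) with he
  have hP : (jacobiP α β (n + 1)).eval x = ∑ s ∈ Finset.range (n + 2), e s := by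
    rw [eval_jacobiP]; push_cast; rfl
  have hterm : (1 - x ^ 2) * (derivative (jacobiP (α + 1) (β + 1) n)).eval x +
        (β - α - (α + β + 2) * x) * (jacobiP (α + 1) (β + 1) n).eval x =
      ∑ s ∈ Finset.range (n + 1), (-2) * (((n : ℝ) + 1 - s) * e s + (s + 1) * e (s + 1)) := by
    rw [jacobiP, derivative_sum, eval_finsetSum, eval_finsetSum, Finset.mul_sum, Finset.mul_sum,
      ← Finset.sum_add_distrib]
    refine Finset.sum_congr rfl fun s hs => ?_
    obtain ⟨t, rfl⟩ := Nat.exists_eq_add_of_le (Nat.lt_succ_iff.1 (Finset.mem_range.1 hs))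
    have c1 := sub_mul_choose (((s + t : ℕ) : ℝ) + 1 + α) t
    have c2 := sub_mul_choose (((s + t : ℕ) : ℝ) + 1 + β) s
    have hd : ∀ k : ℕ, (k : ℝ) * u ^ (k - 1) * u = k * u ^ k := by
      rintro (_ | k) <;> simp [pow_succ, mul_assoc]
    have hd' : ∀ k : ℕ, (k : ℝ) * v ^ (k - 1) * v = k * v ^ k := by
      rintro (_ | k) <;> simp [pow_succ, mul_assoc]
    simp only [he, show s + t + 1 - s = t + 1 by omega, show s + t - s = t by omega,
      show s + t + 1 - (s + 1) = t by omega]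
    have ru : (1 / 2 : ℝ) * (x - 1) = u := by rw [hu]; ring
    have rv : (1 / 2 : ℝ) * (x + 1) = v := by rw [hv]; ring
    simp only [derivative_mul, derivative_pow, derivative_C, derivative_X, derivative_sub,
      derivative_add, derivative_one, eval_add, eval_mul, eval_C, eval_pow, eval_X, eval_sub,
      eval_one, eval_zero, ru, rv]
    rw [show ((s + t : ℕ) : ℝ) + (α + 1) = ((s + t : ℕ) : ℝ) + 1 + α by ring,
      show ((s + t : ℕ) : ℝ) + (β + 1) = ((s + t : ℕ) : ℝ) + 1 + β by ring]
    have hds := hd s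
    have hdt := hd' t
    have hx : 1 - x ^ 2 = -4 * u * v := by rw [hu, hv]; ring
    have hy : β - α - (α + β + 2) * x = -2 * (α + 1) * v - 2 * (β + 1) * u := by rw [hu, hv]; ring
    generalize Ring.choose (((s + t : ℕ) : ℝ) + 1 + α) t = A at *
    generalize Ring.choose (((s + t : ℕ) : ℝ) + 1 + β) s = B at *
    push_cast at c1 c2 ⊢
    linear_combination A * B / 2 * (s * u ^ (s - 1) * v ^ t + t * u ^ s * v ^ (t - 1)) * hx +
      A * B * u ^ s * v ^ t * hy - 2 * A * B * v ^ (t + 1) * hds - 2 * A * B * u ^ (s + 1) * hdt -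
      2 * B * u ^ s * v ^ (t + 1) * c1 - 2 * A * u ^ (s + 1) * v ^ t * c2
  rw [hterm, hP, ← Finset.mul_sum, Finset.sum_add_distrib]
  have e1 : ∑ s ∈ Finset.range (n + 1), ((n : ℝ) + 1 - s) * e s =
      ∑ s ∈ Finset.range (n + 2), ((n : ℝ) + 1 - s) * e s := by
    rw [Finset.sum_range_succ _ (n + 1)]; simp
  have e2 : ∑ s ∈ Finset.range (n + 1), ((s : ℝ) + 1) * e (s + 1) =
      ∑ s ∈ Finset.range (n + 2), (s : ℝ) * e s := by
    rw [Finset.sum_range_succ' _ (n + 1)]; simp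
  rw [e1, e2, ← Finset.sum_add_distrib, Finset.mul_sum, Finset.mul_sum]
  exact Finset.sum_congr rfl fun s _ => by ring

lemma wInt_raise (hα : -1 < α) (hβ : -1 < β) (n : ℕ) (f : ℝ[X]) :
    2 * (n + 1) * wInt α β (f * jacobiP α β (n + 1)) =
      wInt (α + 1) (β + 1) (derivative f * jacobiP (α + 1) (β + 1) n) := by
  have h := wInt_derivative hα hβ (f * jacobiP (α + 1) (β + 1) n)
  have h1 : wInt α β ((1 - X ^ 2) * derivative (f * jacobiP (α + 1) (β + 1) n) +
      (C (β - α) - C (α + β + 2) * X) * (f * jacobiP (α + 1) (β + 1) n)) =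
      wInt α β ((1 - X ^ 2) * (derivative f * jacobiP (α + 1) (β + 1) n) +
        C (-(2 * ((n : ℝ) + 1))) * (f * jacobiP α β (n + 1))) := by
    apply wInt_congr
    intro x
    have := jacobiP_raise (α := α) (β := β) n x
    simp only [derivative_mul, eval_add, eval_mul, eval_C, eval_sub, eval_X, eval_one, eval_pow]
    linear_combination f.eval x * this
  have h2 : wInt α β ((1 - X ^ 2) * (derivative f * jacobiP (α + 1) (β + 1) n)) =
      wInt (α + 1) (β + 1) (derivative f * jacobiP (α + 1) (β + 1) n) := by
    unfold wInt
    refine intervalIntegral.integral_congr fun x hx => ?_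
    rw [Set.uIcc_of_le (by norm_num)] at hx
    have ha : (0 : ℝ) ≤ 1 - x := by linarith [hx.2]
    have hb : (0 : ℝ) ≤ 1 + x := by linarith [hx.1]
    simp only [weight]
    rw [Real.rpow_add_one' ha (by linarith), Real.rpow_add_one' hb (by linarith)]
    simp only [eval_mul, eval_sub, eval_one, eval_pow, eval_X]
    ring
  rw [h1, wInt_add hα hβ, wInt_C_mul, h2] at h
  linarith

/-- By `wInt_raise`, each integration by parts lowers the degree of `f` and the index by one while
raising both parameters; hence the induction is over all `α`, `β`. -/
lemma wInt_mul_jacobiP (hα : -1 < α) (hβ : -1 < β) (f : ℝ[X]) (n : ℕ) (hf : f.degree < n) :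
    wInt α β (f * jacobiP α β n) = 0 := by
  induction n generalizing α β f with
  | zero =>
    have : f = 0 := by
      rw [← degree_eq_bot]
      exact Nat.WithBot.lt_zero_iff.1 hf
    simp [this, wInt_zero]
  | succ n ih =>
    have h := wInt_raise hα hβ n f
    have hd : (derivative f).degree < n := by
      rw [degree_lt_iff_coeff_zero] at hf ⊢
      intro m hm
      rw [coeff_derivative, hf (m + 1) (by omega), zero_mul]
    rw [ih (by linarith) (by linarith) _ hd] at h
    rcases mul_eq_zero.1 h with h | h
    · have : (0 : ℝ) ≤ n := n.cast_nonneg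
      linarith
    · exact h

/-- Once leading terms are matched, the difference has degree below `n` and is orthogonal to all
such polynomials, itself included. The constant need not be known, since it cancels in
`phi4_mul_phi4`. -/
lemma jacobiP_eq (hα : -1 < α) (hβ : -1 < β) (n : ℕ) :
    ∃ c : ℝ, c ≠ 0 ∧ jacobiP α β n = C c * monicJ α β n := by
  set c := (jacobiP α β n).coeff n with hc
  have key : jacobiP α β n - C c * monicJ α β n = 0 := by
    by_contra hne
    set r := jacobiP α β n - C c * monicJ α β n with hr
    have hd : r.degree < n := by
      rw [degree_lt_iff_coeff_zero]
      intro m hm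
      rcases hm.eq_or_lt with rfl | hm
      · have := (monicJ_monic (α := α) (β := β) n).1.coeff_natDegree
        rw [(monicJ_monic n).2] at this
        simp [hr, this, hc]
      · rw [hr, coeff_sub, coeff_C_mul,
          coeff_eq_zero_of_natDegree_lt ((natDegree_jacobiP_le n).trans_lt hm),
          coeff_eq_zero_of_natDegree_lt ((monicJ_monic n).2.trans_lt hm)]
        simp
    have h0 : wInt α β (r * r) = 0 := by
      have : wInt α β (r * r) =
          wInt α β (r * jacobiP α β n - C c * (r * monicJ α β n)) := by
        congr 1
        rw [hr]; ring
      rw [this, wInt_sub hα hβ, wInt_C_mul, wInt_mul_jacobiP hα hβ r n hd,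
        wInt_mul_eq_zero_of_natDegree_lt hα hβ _ n
          (fun k hk => wInt_X_pow_mul_monicJ hα hβ k n hk) r hd]
      simp
    exact (wInt_mul_self_pos hα hβ hne).ne' h0
  refine ⟨c, ?_, sub_eq_zero.1 key⟩
  rintro h0
  rw [h0] at key
  exact jacobiP_ne_zero (β := β) hα n (by simpa using key)

lemma jacobiH_eq (n : ℕ) : jacobiH α β n = wInt α β (jacobiP α β n * jacobiP α β n) := by
  unfold jacobiH wInt weight
  simp only [eval_mul, pow_two, mul_assoc]

open Filter Topology

/-! ### Orthonormal polynomials -/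

/-- The off-diagonal recurrence coefficient of the orthonormal Jacobi polynomials. -/
def recSqrt (α β : ℝ) (n : ℕ) : ℝ := √(recA α β n)

/-- The orthonormal Jacobi polynomials. -/
def orthoJ (α β : ℝ) (n : ℕ) : ℝ[X] := C (1 / √(normSq α β n)) * monicJ α β n

lemma recSqrt_zero : recSqrt α β 0 = 0 := by simp [recSqrt, recA]

lemma recSqrt_succ_pos (hα : -1 < α) (hβ : -1 < β) (n : ℕ) : 0 < recSqrt α β (n + 1) :=
  Real.sqrt_pos.2 (recA_succ_pos hα hβ n)

lemma recSqrt_sq (hα : -1 < α) (hβ : -1 < β) (n : ℕ) : recSqrt α β n ^ 2 = recA α β n := by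
  rcases n with _ | n
  · simp [recSqrt, recA]
  · exact Real.sq_sqrt (recA_succ_pos hα hβ n).le

lemma sqrt_normSq_succ (hα : -1 < α) (hβ : -1 < β) (n : ℕ) :
    √(normSq α β (n + 1)) = recSqrt α β (n + 1) * √(normSq α β n) := by
  rw [normSq_succ hα hβ, Real.sqrt_mul (recA_succ_pos hα hβ n).le, recSqrt]

lemma eval_monicJ (hα : -1 < α) (hβ : -1 < β) (n : ℕ) (x : ℝ) :
    (monicJ α β n).eval x = √(normSq α β n) * (orthoJ α β n).eval x := by
  have := Real.sqrt_pos.2 (normSq_pos hα hβ n)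
  simp only [orthoJ, eval_mul, eval_C]
  field_simp

lemma eval_derivative_monicJ (hα : -1 < α) (hβ : -1 < β) (n : ℕ) (x : ℝ) :
    (derivative (monicJ α β n)).eval x =
      √(normSq α β n) * (derivative (orthoJ α β n)).eval x := by
  have := Real.sqrt_pos.2 (normSq_pos hα hβ n)
  simp only [orthoJ, derivative_C_mul, eval_mul, eval_C]
  field_simp

lemma orthoJ_rec (hα : -1 < α) (hβ : -1 < β) (n : ℕ) (x : ℝ) :
    x * (orthoJ α β n).eval x = recSqrt α β (n + 1) * (orthoJ α β (n + 1)).eval x +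
      recB α β n * (orthoJ α β n).eval x + recSqrt α β n * (orthoJ α β (n - 1)).eval x := by
  have h := eval_X_mul_monicJ (α := α) (β := β) n x
  have hp := Real.sqrt_pos.2 (normSq_pos hα hβ n)
  apply mul_left_cancel₀ hp.ne'
  rw [eval_monicJ hα hβ, eval_monicJ hα hβ, eval_monicJ hα hβ, sqrt_normSq_succ hα hβ,
    ← recSqrt_sq hα hβ] at h
  -- For `n = 0` the index `n - 1` truncates to `0`; the spurious term is killed by `recSqrt α β 0 =
  -- 0`.
  rcases n with _ | n
  · rw [recSqrt_zero] at h ⊢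
    linear_combination h
  · simp only [Nat.add_sub_cancel] at *
    have hs := sqrt_normSq_succ hα hβ n
    linear_combination h - recSqrt α β (n + 1) * (orthoJ α β n).eval x * hs

lemma orthoJ_derivative_succ (hα : -1 < α) (hβ : -1 < β) (n : ℕ) (x : ℝ) :
    (1 - x ^ 2) * (derivative (orthoJ α β (n + 1))).eval x =
      (subCoeff α β (n + 1) - (n + 1) * x) * (orthoJ α β (n + 1)).eval x +
        (2 * n + α + β + 3) * recSqrt α β (n + 1) * (orthoJ α β n).eval x := by
  have h := (monicJ_derivative hα hβ n x).1
  have hp := Real.sqrt_pos.2 (normSq_pos hα hβ (n + 1))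
  apply mul_left_cancel₀ hp.ne'
  rw [eval_monicJ hα hβ, eval_monicJ hα hβ, eval_derivative_monicJ hα hβ, ← recSqrt_sq hα hβ] at h
  have hs := sqrt_normSq_succ hα hβ n
  linear_combination h - (2 * n + α + β + 3) * recSqrt α β (n + 1) * (orthoJ α β n).eval x * hs

lemma orthoJ_derivative (hα : -1 < α) (hβ : -1 < β) (n : ℕ) (x : ℝ) :
    (1 - x ^ 2) * (derivative (orthoJ α β n)).eval x =
      (subCoeff α β n - n * x) * (orthoJ α β n).eval x +
        (2 * n + α + β + 1) * ((x - recB α β n) * (orthoJ α β n).eval x -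
          recSqrt α β (n + 1) * (orthoJ α β (n + 1)).eval x) := by
  have h := (monicJ_derivative hα hβ n x).2
  have hp := Real.sqrt_pos.2 (normSq_pos hα hβ n)
  apply mul_left_cancel₀ hp.ne'
  rw [eval_monicJ hα hβ, eval_monicJ hα hβ, eval_derivative_monicJ hα hβ,
    sqrt_normSq_succ hα hβ] at h
  linear_combination h

/-- The Christoffel–Darboux formula. -/
lemma christoffel_darboux (hα : -1 < α) (hβ : -1 < β) (n : ℕ) (x y : ℝ) :
    (x - y) * ∑ j ∈ Finset.range (n + 1), (orthoJ α β j).eval x * (orthoJ α β j).eval y =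
      recSqrt α β (n + 1) * ((orthoJ α β (n + 1)).eval x * (orthoJ α β n).eval y -
        (orthoJ α β n).eval x * (orthoJ α β (n + 1)).eval y) := by
  induction n with
  | zero =>
    have hx := orthoJ_rec hα hβ 0 x
    have hy := orthoJ_rec hα hβ 0 y
    rw [recSqrt_zero] at hx hy
    rw [Finset.sum_range_one]
    linear_combination (orthoJ α β 0).eval y * hx - (orthoJ α β 0).eval x * hy
  | succ n ih =>
    have hx := orthoJ_rec hα hβ (n + 1) x
    have hy := orthoJ_rec hα hβ (n + 1) y
    simp only [Nat.add_sub_cancel] at hx hy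
    rw [Finset.sum_range_succ, mul_add, ih]
    linear_combination (orthoJ α β (n + 1)).eval y * hx - (orthoJ α β (n + 1)).eval x * hy

lemma wInt_orthoJ_mul (hα : -1 < α) (hβ : -1 < β) (m n : ℕ) :
    wInt α β (orthoJ α β m * orthoJ α β n) = if m = n then 1 else 0 := by
  have h : wInt α β (orthoJ α β m * orthoJ α β n) =
      1 / √(normSq α β m) * (1 / √(normSq α β n) * wInt α β (monicJ α β m * monicJ α β n)) := by
    rw [← wInt_C_mul, ← wInt_C_mul]
    congr 1
    simp only [orthoJ]
    ring
  rw [h]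
  split_ifs with hmn
  · subst hmn
    have hp := normSq_pos hα hβ m
    have := Real.sqrt_pos.2 hp
    rw [show wInt α β (monicJ α β m * monicJ α β m) = √(normSq α β m) * √(normSq α β m) from
      (Real.mul_self_sqrt hp.le).symm]
    field_simp
  · rcases lt_or_gt_of_ne hmn with hlt | hlt
    · rw [wInt_monicJ_mul_of_lt hα hβ hlt]; simp
    · rw [mul_comm (monicJ α β m), wInt_monicJ_mul_of_lt hα hβ hlt]; simp

/-! ### Asymptotics of the recurrence coefficients -/

lemma exists_linear_lower_bound (hα : -1 < α) (hβ : -1 < β) :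
    ∃ κ : ℝ, 0 < κ ∧ ∀ n : ℕ, 1 ≤ n → κ * n ≤ 2 * n + α + β := by
  refine ⟨min 2 (2 + (α + β)), lt_min (by norm_num) (by linarith), fun n hn => ?_⟩
  have h1 : (1 : ℝ) ≤ n := by exact_mod_cast hn
  rcases le_total 0 (α + β) with h | h
  · rw [min_eq_left (by linarith)]; linarith
  · rw [min_eq_right (by linarith)]; nlinarith

lemma abs_subCoeff_le (hα : -1 < α) (hβ : -1 < β) :
    ∃ K : ℝ, ∀ n : ℕ, 1 ≤ n → |subCoeff α β n| ≤ K := by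
  obtain ⟨κ, hκ, h⟩ := exists_linear_lower_bound hα hβ
  refine ⟨|α - β| / κ, fun n hn => ?_⟩
  have h1 : (1 : ℝ) ≤ n := by exact_mod_cast hn
  have hm := two_mul_add_pos hα hβ hn
  rw [subCoeff, abs_div, abs_mul, Nat.abs_cast, abs_of_pos hm, div_le_div_iff₀ hm hκ]
  have := mul_le_mul_of_nonneg_left (h n hn) (abs_nonneg (α - β))
  linarith

lemma abs_recB_le (hα : -1 < α) (hβ : -1 < β) :
    ∃ K : ℝ, 0 ≤ K ∧ ∀ n : ℕ, 1 ≤ n → |recB α β n| ≤ K / n ^ 2 := by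
  obtain ⟨κ, hκ, h⟩ := exists_linear_lower_bound hα hβ
  refine ⟨|(α + β) * (α - β)| / κ ^ 2, by positivity, fun n hn => ?_⟩
  have h1 : (1 : ℝ) ≤ n := by exact_mod_cast hn
  have hm := two_mul_add_pos hα hβ hn
  have hg1 := mul_subCoeff hα hβ n
  have hg2 := mul_subCoeff hα hβ (n + 1)
  push_cast at hg2
  have hb : (2 * (n : ℝ) + α + β) * (2 * ((n : ℝ) + 1) + α + β) * recB α β n =
      -((α + β) * (α - β)) := by
    simp only [recB]
    linear_combination (2 * ((n : ℝ) + 1) + α + β) * hg1 - (2 * (n : ℝ) + α + β) * hg2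
  have hm2 : 0 < 2 * ((n : ℝ) + 1) + α + β := by linarith
  have hb' := congrArg abs hb
  rw [abs_neg, abs_mul, abs_of_pos (mul_pos hm hm2)] at hb'
  rw [← hb', div_div, le_div_iff₀ (by positivity), mul_comm]
  refine mul_le_mul_of_nonneg_right ?_ (abs_nonneg _)
  have hk := h n hn
  calc κ ^ 2 * (n : ℝ) ^ 2 = (κ * n) * (κ * n) := by ring
    _ ≤ _ := mul_le_mul hk (by linarith) (by positivity) hm.le

/-- The hypothesis is `recA_closed` with `m = 2n + α + β`, `s = α + β`, `d = α - β`. Subtracting the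
case `4 a^2 = 1` leaves a remainder of order `m^2` against `m^2 (m^2 - 1)`, and `a + 1/2 ≥ 1/2`
passes from `a^2` to `a`. -/
lemma abs_sub_half_mul_le {a m s d : ℝ} (hm : 2 < m) (ha : 0 ≤ a)
    (h : m ^ 2 * (m ^ 2 - 1) * (4 * a ^ 2) = (m ^ 2 - s ^ 2) * (m ^ 2 - d ^ 2)) :
    |a - 1 / 2| * m ^ 2 ≤ |1 - s ^ 2 - d ^ 2| + s ^ 2 * d ^ 2 := by
  have hm0 : 1 ≤ m ^ 2 := one_le_pow₀ (by linarith)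
  have hm1 : m ^ 2 ≤ 2 * (m ^ 2 - 1) := by nlinarith
  have e : m ^ 2 * (m ^ 2 - 1) * (4 * ((a - 1 / 2) * (a + 1 / 2))) =
      m ^ 2 * (1 - s ^ 2 - d ^ 2) + s ^ 2 * d ^ 2 := by
    linear_combination h
  have e' := congrArg abs e
  rw [abs_mul, abs_mul 4, abs_mul (a - 1 / 2), abs_of_nonneg (show 0 ≤ a + 1 / 2 by linarith),
    abs_of_nonneg (mul_nonneg (by linarith) (by linarith) : 0 ≤ m ^ 2 * (m ^ 2 - 1)),
    abs_of_nonneg (by norm_num : (0 : ℝ) ≤ 4)] at e'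
  have e1 : |m ^ 2 * (1 - s ^ 2 - d ^ 2) + s ^ 2 * d ^ 2| ≤
      m ^ 2 * (|1 - s ^ 2 - d ^ 2| + s ^ 2 * d ^ 2) := by
    refine (abs_add_le _ _).trans ?_
    rw [abs_mul, abs_of_nonneg (sq_nonneg m), abs_of_nonneg (a := s ^ 2 * d ^ 2) (by positivity),
      mul_add]
    exact add_le_add_right (le_mul_of_one_le_left (by positivity) hm0) _
  have e2 : (m ^ 2 - 1) * (4 * (|a - 1 / 2| * (a + 1 / 2))) ≤
      |1 - s ^ 2 - d ^ 2| + s ^ 2 * d ^ 2 := by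
    refine le_of_mul_le_mul_left (a := m ^ 2) ?_ (by linarith)
    rw [← mul_assoc, e']; exact e1
  have hx := abs_nonneg (a - 1 / 2)
  calc |a - 1 / 2| * m ^ 2 ≤ |a - 1 / 2| * (2 * (m ^ 2 - 1)) := mul_le_mul_of_nonneg_left hm1 hx
    _ = (m ^ 2 - 1) * (4 * (|a - 1 / 2| * (1 / 2))) := by ring
    _ ≤ (m ^ 2 - 1) * (4 * (|a - 1 / 2| * (a + 1 / 2))) := by
        gcongr
        linarith
    _ ≤ _ := e2

lemma abs_recSqrt_sub_le (hα : -1 < α) (hβ : -1 < β) :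
    ∃ K : ℝ, 0 ≤ K ∧ ∀ n : ℕ, 1 ≤ n → |recSqrt α β n - 1 / 2| ≤ K / n ^ 2 := by
  obtain ⟨κ, hκ, h⟩ := exists_linear_lower_bound hα hβ
  set S := |1 - (α + β) ^ 2 - (α - β) ^ 2| + (α + β) ^ 2 * (α - β) ^ 2 with hS
  have hS0 : 0 ≤ S := by positivity
  -- The index `1` is absorbed into the constant, because `2 + α + β > 2` can fail.
  refine ⟨max (S / κ ^ 2) |recSqrt α β 1 - 1 / 2|, le_max_of_le_right (abs_nonneg _),
    fun n hn => ?_⟩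
  rcases hn.eq_or_lt with rfl | hn2
  · simp
  refine le_trans ?_ (div_le_div_of_nonneg_right (le_max_left _ _) (by positivity))
  have h1 : (2 : ℝ) ≤ n := by exact_mod_cast hn2
  obtain ⟨k, rfl⟩ := Nat.exists_eq_add_of_le' hn
  have hA := recA_closed hα hβ k
  have hpos := recSqrt_succ_pos hα hβ k
  rw [← recSqrt_sq hα hβ] at hA
  have hk := h (k + 1) hn
  push_cast at h1 hk ⊢
  obtain ⟨m, hm⟩ : ∃ m, m = 2 * ((k : ℝ) + 1) + α + β := ⟨_, rfl⟩
  have hm2 : 2 < m := by rw [hm]; linarith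
  have key := abs_sub_half_mul_le (s := α + β) (d := α - β) hm2 hpos.le (by
    have : (k : ℝ) = (m - 2 - α - β) / 2 := by rw [hm]; ring
    rw [this] at hA
    linear_combination 4 * hA)
  rw [div_div, le_div_iff₀ (by positivity)]
  have e5 : κ ^ 2 * ((k : ℝ) + 1) ^ 2 ≤ m ^ 2 := by
    rw [← mul_pow, hm]; exact pow_le_pow_left₀ (by positivity) hk 2
  exact (mul_le_mul_of_nonneg_left e5 (abs_nonneg _)).trans key

lemma tendsto_div_natCast_sq (K : ℝ) : Tendsto (fun n : ℕ => K / (n : ℝ) ^ 2) atTop (𝓝 0) :=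
  tendsto_const_nhds.div_atTop
    ((tendsto_pow_atTop (by norm_num)).comp tendsto_natCast_atTop_atTop)

lemma tendsto_recSqrt (hα : -1 < α) (hβ : -1 < β) : Tendsto (recSqrt α β) atTop (𝓝 (1 / 2)) := by
  obtain ⟨K, -, h⟩ := abs_recSqrt_sub_le hα hβ
  rw [tendsto_iff_norm_sub_tendsto_zero]
  refine squeeze_zero' (Eventually.of_forall fun _ => norm_nonneg _) ?_ (tendsto_div_natCast_sq K)
  filter_upwards [eventually_ge_atTop 1] with n hn using h n hn

lemma tendsto_recB (hα : -1 < α) (hβ : -1 < β) : Tendsto (recB α β) atTop (𝓝 0) := by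
  obtain ⟨K, -, h⟩ := abs_recB_le hα hβ
  rw [tendsto_zero_iff_norm_tendsto_zero]
  refine squeeze_zero' (Eventually.of_forall fun _ => norm_nonneg _) ?_ (tendsto_div_natCast_sq K)
  filter_upwards [eventually_ge_atTop 1] with n hn using h n hn

lemma exists_inv_recSqrt_le (hα : -1 < α) (hβ : -1 < β) :
    ∃ K : ℝ, 0 < K ∧ ∀ n : ℕ, 1 ≤ recSqrt α β (n + 1) * K := by
  have h := ((tendsto_recSqrt hα hβ).comp (tendsto_add_atTop_nat 1)).inv₀ (by norm_num)
  obtain ⟨K, hK⟩ := h.bddAbove_range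
  have hb : ∀ n, (recSqrt α β (n + 1))⁻¹ ≤ K := fun n => hK ⟨n, rfl⟩
  refine ⟨K, (inv_pos.2 (recSqrt_succ_pos hα hβ 0)).trans_le (hb 0), fun n => ?_⟩
  have hp := recSqrt_succ_pos hα hβ n
  have := mul_le_mul_of_nonneg_left (hb n) hp.le
  rwa [mul_inv_cancel₀ hp.ne'] at this

/-! ### Turán determinants -/

/-- The Turán-type quadratic form in two consecutive orthonormal Jacobi polynomials. -/
def turan (α β : ℝ) (n : ℕ) : ℝ[X] :=
  orthoJ α β n * orthoJ α β n + orthoJ α β (n + 1) * orthoJ α β (n + 1) -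
    C 2 * (X * orthoJ α β n * orthoJ α β (n + 1))

lemma eval_turan (n : ℕ) (x : ℝ) : (turan α β n).eval x =
    (orthoJ α β n).eval x ^ 2 + (orthoJ α β (n + 1)).eval x ^ 2 -
      2 * x * (orthoJ α β n).eval x * (orthoJ α β (n + 1)).eval x := by
  simp only [turan, eval_add, eval_sub, eval_mul, eval_X, eval_C]
  ring

lemma turan_nonneg (n : ℕ) {x : ℝ} (hx : x ∈ Set.Icc (-1 : ℝ) 1) : 0 ≤ (turan α β n).eval x := by
  rw [eval_turan]
  have h : 0 ≤ 1 - x ^ 2 := by nlinarith [hx.1, hx.2]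
  nlinarith [sq_nonneg ((orthoJ α β n).eval x - x * (orthoJ α β (n + 1)).eval x),
    mul_nonneg h (sq_nonneg ((orthoJ α β (n + 1)).eval x))]

/-- Twice the form minus the sum of squares equals `(1/2 - x)(p + q)^2 + (1/2 + x)(p - q)^2`. This
coercivity turns bounds on the Turán form into bounds on the polynomials. -/
lemma sq_add_sq_le_turan (n : ℕ) {x : ℝ} (hx : |x| ≤ 1 / 2) :
    (orthoJ α β n).eval x ^ 2 + (orthoJ α β (n + 1)).eval x ^ 2 ≤ 2 * (turan α β n).eval x := by
  rw [eval_turan]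
  obtain ⟨h1, h2⟩ := abs_le.1 hx
  generalize (orthoJ α β n).eval x = p
  generalize (orthoJ α β (n + 1)).eval x = q
  nlinarith [mul_nonneg (by linarith : 0 ≤ 1 / 2 - x) (sq_nonneg (p + q)),
    mul_nonneg (by linarith : 0 ≤ 1 / 2 + x) (sq_nonneg (p - q))]

/-- The increment factors as `(p_{n+2} - p_n)(p_{n+2} + p_n - 2 x p_{n+1})`, and by the recurrence
the second factor sees only the deviations of the coefficients from `1/2` and `0`. -/
lemma abs_turan_succ_sub_le (hα : -1 < α) (hβ : -1 < β) :
    ∃ c : ℝ, 0 ≤ c ∧ ∀ (n : ℕ) (x : ℝ), |x| ≤ 1 / 2 →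
      |(turan α β (n + 1)).eval x - (turan α β n).eval x| ≤
        c / ((n : ℝ) + 1) ^ 2 * (turan α β n).eval x := by
  obtain ⟨A, hA0, hA⟩ := abs_recSqrt_sub_le hα hβ
  obtain ⟨B, hB0, hB⟩ := abs_recB_le hα hβ
  obtain ⟨K, hK0, hK⟩ := exists_inv_recSqrt_le hα hβ
  set K1 := K * (1 + A + B) with hK1
  have hK10 : 0 ≤ K1 := by positivity
  refine ⟨4 * (K1 + 1) * (A * K1 + A + B), by positivity, fun n x hx => ?_⟩
  have hrec := orthoJ_rec hα hβ (n + 1) x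
  have hlow := sq_add_sq_le_turan (α := α) (β := β) n hx
  have hd : (turan α β (n + 1)).eval x - (turan α β n).eval x =
      ((orthoJ α β (n + 2)).eval x - (orthoJ α β n).eval x) *
        (2 * ((1 / 2 - recSqrt α β (n + 2)) * (orthoJ α β (n + 2)).eval x +
          (1 / 2 - recSqrt α β (n + 1)) * (orthoJ α β n).eval x -
          recB α β (n + 1) * (orthoJ α β (n + 1)).eval x)) := by
    rw [eval_turan, eval_turan]
    simp only [Nat.add_sub_cancel] at hrec
    linear_combination (-2) * ((orthoJ α β (n + 2)).eval x - (orthoJ α β n).eval x) * hrec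
  rw [hd]
  simp only [Nat.add_sub_cancel] at hrec
  have hn : (0 : ℝ) ≤ n := n.cast_nonneg
  have hA2 : |1 / 2 - recSqrt α β (n + 2)| ≤ A / ((n : ℝ) + 1) ^ 2 := by
    rw [abs_sub_comm]
    refine (hA (n + 2) (by omega)).trans (div_le_div_of_nonneg_left hA0 (by positivity) ?_)
    push_cast
    exact pow_le_pow_left₀ (by positivity) (by linarith) 2
  have hA1 : |1 / 2 - recSqrt α β (n + 1)| ≤ A / ((n : ℝ) + 1) ^ 2 := by
    rw [abs_sub_comm]; simpa using hA (n + 1) (by omega)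
  have hB1 : |recB α β (n + 1)| ≤ B / ((n : ℝ) + 1) ^ 2 := by
    simpa using hB (n + 1) (by omega)
  have hpos := recSqrt_succ_pos hα hβ (n + 1)
  have hpos1 := recSqrt_succ_pos hα hβ n
  have hKn := hK (n + 1)
  have hT : 0 ≤ (turan α β n).eval x := by nlinarith
  have hs := Real.sq_sqrt (mul_nonneg zero_le_two hT)
  have hs0 := Real.sqrt_nonneg (2 * (turan α β n).eval x)
  set s := √(2 * (turan α β n).eval x)
  set p0 := (orthoJ α β n).eval x
  set p1 := (orthoJ α β (n + 1)).eval x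
  set p2 := (orthoJ α β (n + 2)).eval x
  have hp0 : |p0| ≤ s := abs_le_of_sq_le_sq (by nlinarith) hs0
  have hp1 : |p1| ≤ s := abs_le_of_sq_le_sq (by nlinarith) hs0
  have hd1 : (1 : ℝ) ≤ ((n : ℝ) + 1) ^ 2 := one_le_pow₀ (by linarith)
  have hp2 : |p2| ≤ K1 * s := by
    have e : recSqrt α β (n + 2) * p2 = (x - recB α β (n + 1)) * p1 - recSqrt α β (n + 1) * p0 := by
      linear_combination -hrec
    have e1 : |recSqrt α β (n + 2) * p2| ≤ (1 + A + B) * s := by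
      rw [e]
      have f1 : |x - recB α β (n + 1)| ≤ 1 / 2 + B :=
        (abs_sub _ _).trans (add_le_add hx (hB1.trans (div_le_self hB0 hd1)))
      have f2 : |recSqrt α β (n + 1)| ≤ 1 / 2 + A := by
        have := hA1.trans (div_le_self hA0 hd1)
        rw [abs_le] at this
        rw [abs_of_pos hpos1]
        linarith
      calc _ ≤ |(x - recB α β (n + 1)) * p1| + |recSqrt α β (n + 1) * p0| := abs_sub _ _
        _ ≤ (1 / 2 + B) * s + (1 / 2 + A) * s := by
            rw [abs_mul, abs_mul]; gcongr
        _ = _ := by ring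
    rw [abs_mul, abs_of_pos hpos] at e1
    calc |p2| ≤ (recSqrt α β (n + 2) * K) * |p2| := le_mul_of_one_le_left (abs_nonneg _) hKn
      _ = K * (recSqrt α β (n + 2) * |p2|) := by ring
      _ ≤ K * ((1 + A + B) * s) := by gcongr
      _ = K1 * s := by rw [hK1]; ring
  rw [abs_mul, abs_mul 2, abs_two]
  have g1 : |p2 - p0| ≤ K1 * s + s := (abs_sub _ _).trans (add_le_add hp2 hp0)
  have g2 : |(1 / 2 - recSqrt α β (n + 2)) * p2 + (1 / 2 - recSqrt α β (n + 1)) * p0 -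
      recB α β (n + 1) * p1| ≤ A / ((n : ℝ) + 1) ^ 2 * (K1 * s) + A / ((n : ℝ) + 1) ^ 2 * s +
        B / ((n : ℝ) + 1) ^ 2 * s := by
    refine (abs_sub _ _).trans (add_le_add ((abs_add_le _ _).trans (add_le_add ?_ ?_)) ?_) <;>
    · rw [abs_mul]
      gcongr
  calc _ ≤ (K1 * s + s) * (2 * (A / ((n : ℝ) + 1) ^ 2 * (K1 * s) + A / ((n : ℝ) + 1) ^ 2 * s +
        B / ((n : ℝ) + 1) ^ 2 * s)) := by gcongr
    _ = 2 * (K1 + 1) * (A * K1 + A + B) / ((n : ℝ) + 1) ^ 2 * s ^ 2 := by ring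
    _ = _ := by rw [hs]; ring

lemma inv_sq_le_telescope (n : ℕ) :
    1 / ((n : ℝ) + 1) ^ 2 ≤ 2 * (1 / ((n : ℝ) + 1) - 1 / ((n : ℝ) + 2)) := by
  have hn : (0 : ℝ) ≤ n := n.cast_nonneg
  rw [div_sub_div _ _ (by positivity) (by positivity), ← mul_div_assoc,
    div_le_div_iff₀ (by positivity) (by positivity)]
  nlinarith

/-- A discrete Grönwall inequality; the exponent `2 * c` comes from the telescoping bound for the
sum of `1 / (k + 1)^2`. -/
lemma le_mul_exp_of_abs_succ_sub_le {u : ℕ → ℝ} {c : ℝ} (hu : ∀ n, 0 ≤ u n) (hc : 0 ≤ c)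
    (h : ∀ n : ℕ, |u (n + 1) - u n| ≤ c / ((n : ℝ) + 1) ^ 2 * u n) (n : ℕ) :
    u n ≤ u 0 * Real.exp (2 * c) := by
  have key : ∀ n : ℕ, u n ≤ u 0 * Real.exp (2 * c * (1 - 1 / ((n : ℝ) + 1))) := by
    intro n
    induction n with
    | zero => simp
    | succ n ih =>
      have h1 := (abs_le.1 (h n)).2
      have h2 := Real.add_one_le_exp (c / ((n : ℝ) + 1) ^ 2)
      have h3 := mul_le_mul_of_nonneg_left (inv_sq_le_telescope n) hc
      calc u (n + 1) ≤ (c / ((n : ℝ) + 1) ^ 2 + 1) * u n := by linarith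
        _ ≤ Real.exp (c / ((n : ℝ) + 1) ^ 2) *
            (u 0 * Real.exp (2 * c * (1 - 1 / ((n : ℝ) + 1)))) :=
          mul_le_mul h2 ih (hu n) (Real.exp_pos _).le
        _ = u 0 * Real.exp (c / ((n : ℝ) + 1) ^ 2 + 2 * c * (1 - 1 / ((n : ℝ) + 1))) := by
          rw [Real.exp_add]; ring
        _ ≤ _ := by
          refine mul_le_mul_of_nonneg_left (Real.exp_le_exp.2 ?_) (hu 0)
          push_cast
          rw [show (n : ℝ) + 1 + 1 = n + 2 by ring]
          rw [mul_one_div] at h3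
          linarith
  refine (key n).trans (mul_le_mul_of_nonneg_left (Real.exp_le_exp.2 ?_) (hu 0))
  have : 0 ≤ 1 / ((n : ℝ) + 1) := by positivity
  nlinarith

lemma abs_sub_le_of_abs_succ_sub_le {u : ℕ → ℝ} {c : ℝ} (hc : 0 ≤ c)
    (h : ∀ n : ℕ, |u (n + 1) - u n| ≤ c / ((n : ℝ) + 1) ^ 2) {m n : ℕ} (hmn : n ≤ m) :
    |u m - u n| ≤ 2 * c / ((n : ℝ) + 1) := by
  have key : |u m - u n| ≤ 2 * c * (1 / ((n : ℝ) + 1) - 1 / ((m : ℝ) + 1)) := by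
    induction m, hmn using Nat.le_induction with
    | base => simp
    | succ m _ ih =>
      have h3 := mul_le_mul_of_nonneg_left (inv_sq_le_telescope m) hc
      rw [mul_one_div] at h3
      push_cast
      rw [show (m : ℝ) + 1 + 1 = m + 2 by ring]
      have := abs_sub_le (u (m + 1)) (u m) (u n)
      linarith [h m]
  refine key.trans ?_
  have : 0 ≤ 2 * c * (1 / ((m : ℝ) + 1)) := by positivity
  rw [mul_sub, mul_one_div]
  linarith

lemma exists_turan_le (hα : -1 < α) (hβ : -1 < β) :
    ∃ B : ℝ, 0 ≤ B ∧ ∀ (n : ℕ) (x : ℝ), |x| ≤ 1 / 2 → (turan α β n).eval x ≤ B := by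
  obtain ⟨c, hc, h⟩ := abs_turan_succ_sub_le hα hβ
  obtain ⟨M, hM⟩ := (isCompact_Icc (a := (-(1 / 2) : ℝ)) (b := 1 / 2)).bddAbove_image
    (turan α β 0).continuous.continuousOn
  have hT : ∀ (n : ℕ) (x : ℝ), |x| ≤ 1 / 2 → 0 ≤ (turan α β n).eval x := fun n x hx =>
    turan_nonneg n ⟨by linarith [(abs_le.1 hx).1], by linarith [(abs_le.1 hx).2]⟩
  have hM' : ∀ x : ℝ, |x| ≤ 1 / 2 → (turan α β 0).eval x ≤ M := fun x hx =>
    hM ⟨x, abs_le.1 hx, rfl⟩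
  have hM0 : 0 ≤ M := (hT 0 0 (by norm_num)).trans (hM' 0 (by norm_num))
  refine ⟨M * Real.exp (2 * c), by positivity, fun n x hx => ?_⟩
  exact (le_mul_exp_of_abs_succ_sub_le (fun n => hT n x hx) hc (fun n => h n x hx) n).trans
    (mul_le_mul_of_nonneg_right (hM' x hx) (Real.exp_pos _).le)

lemma exists_abs_turan_sub_le (hα : -1 < α) (hβ : -1 < β) :
    ∃ c : ℝ, 0 ≤ c ∧ ∀ (n m : ℕ) (x : ℝ), |x| ≤ 1 / 2 → n ≤ m →
      |(turan α β m).eval x - (turan α β n).eval x| ≤ c / ((n : ℝ) + 1) := by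
  obtain ⟨c, hc, h⟩ := abs_turan_succ_sub_le hα hβ
  obtain ⟨B, hB0, hB⟩ := exists_turan_le hα hβ
  refine ⟨2 * (c * B), by positivity, fun n m x hx hnm => ?_⟩
  refine abs_sub_le_of_abs_succ_sub_le (u := fun n => (turan α β n).eval x) (by positivity)
    (fun k => (h k x hx).trans ?_) hnm
  rw [mul_div_right_comm]
  exact mul_le_mul_of_nonneg_left (hB k x hx) (by positivity)

/-- Consecutive orthonormal Jacobi polynomials are uniformly bounded on `[-1/2, 1/2]`. -/
lemma exists_abs_orthoJ_le (hα : -1 < α) (hβ : -1 < β) :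
    ∃ B : ℝ, 0 ≤ B ∧ ∀ (n : ℕ) (x : ℝ), |x| ≤ 1 / 2 → |(orthoJ α β n).eval x| ≤ B := by
  obtain ⟨B, hB0, hB⟩ := exists_turan_le hα hβ
  refine ⟨√(2 * B), Real.sqrt_nonneg _, fun n x hx => Real.abs_le_sqrt ?_⟩
  have h1 := hB n x hx
  have h2 := sq_add_sq_le_turan (α := α) (β := β) n hx
  nlinarith [sq_nonneg ((orthoJ α β (n + 1)).eval x)]

lemma exists_tendsto_turan_zero (hα : -1 < α) (hβ : -1 < β) :
    ∃ L c : ℝ, Tendsto (fun n => (turan α β n).eval 0) atTop (𝓝 L) ∧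
      ∀ n : ℕ, |(turan α β n).eval 0 - L| ≤ c / ((n : ℝ) + 1) := by
  obtain ⟨c, hc, h⟩ := exists_abs_turan_sub_le hα hβ
  have hcau : CauchySeq (fun n => (turan α β n).eval 0) := by
    refine cauchySeq_of_le_tendsto_0' (fun n : ℕ => c / ((n : ℝ) + 1)) (fun n m hnm => ?_)
      (tendsto_const_nhds.div_atTop (tendsto_atTop_add_const_right _ _ tendsto_natCast_atTop_atTop))
    rw [dist_comm]
    exact h n m 0 (by norm_num) hnm
  obtain ⟨L, hL⟩ := cauchySeq_tendsto_of_complete hcau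
  refine ⟨L, c, hL, fun n => ?_⟩
  rw [abs_sub_comm]
  refine le_of_tendsto ((hL.sub_const _).abs) ?_
  filter_upwards [eventually_ge_atTop n] with m hm using h n m 0 (by norm_num) hm

/-! ### Weak limits of products of orthonormal polynomials -/

/-- The Fourier-cosine functional of a polynomial against the arcsine law. -/
def cosInt (f : ℝ[X]) (k : ℝ) : ℝ :=
  1 / Real.pi * ∫ θ in (0 : ℝ)..Real.pi, f.eval (Real.cos θ) * Real.cos (k * θ)

lemma cosInt_add (f g : ℝ[X]) (k : ℝ) : cosInt (f + g) k = cosInt f k + cosInt g k := by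
  unfold cosInt
  rw [← mul_add, ← intervalIntegral.integral_add]
  · simp only [eval_add, add_mul]
  · exact Continuous.intervalIntegrable (by fun_prop) _ _
  · exact Continuous.intervalIntegrable (by fun_prop) _ _

lemma cosInt_C_mul (c : ℝ) (f : ℝ[X]) (k : ℝ) : cosInt (C c * f) k = c * cosInt f k := by
  unfold cosInt
  rw [mul_left_comm, ← intervalIntegral.integral_const_mul c]
  simp only [eval_mul, eval_C, mul_assoc]

lemma cosInt_X_mul (f : ℝ[X]) (k : ℝ) :
    cosInt (X * f) k = 1 / 2 * cosInt f (k + 1) + 1 / 2 * cosInt f (k - 1) := by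
  unfold cosInt
  rw [mul_left_comm, mul_left_comm (1 / 2), ← mul_add,
    ← intervalIntegral.integral_const_mul (1 / 2), ← intervalIntegral.integral_const_mul (1 / 2), ← intervalIntegral.integral_add]
  · congr 2
    ext θ
    rw [add_mul, sub_mul, one_mul, Real.cos_add, Real.cos_sub]
    simp only [eval_mul, eval_X]
    ring
  · exact Continuous.intervalIntegrable (by fun_prop) _ _
  · exact Continuous.intervalIntegrable (by fun_prop) _ _

lemma cosInt_one (i j : ℕ) : cosInt 1 ((i : ℝ) - j) = if i = j then 1 else 0 := by
  unfold cosInt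
  split_ifs with h
  · subst h
    simp [Real.pi_ne_zero]
  · have hk : (i : ℝ) - j ≠ 0 := sub_ne_zero.2 (by exact_mod_cast h)
    have hs : Real.sin (((i : ℝ) - j) * Real.pi) = 0 := by
      rw [Real.sin_eq_zero_iff]
      exact ⟨(i : ℤ) - j, by push_cast; ring⟩
    simp [intervalIntegral.integral_comp_mul_left (fun t => Real.cos t) hk, hs]

/-- In the limit, multiplication by `X` averages the two neighbouring indices. The cosine functional
obeys the same rule by `2 cos θ cos kθ = cos (k+1)θ + cos (k-1)θ`. -/
lemma tendsto_wInt_X_pow (hα : -1 < α) (hβ : -1 < β) (k i j : ℕ) :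
    Tendsto (fun n => wInt α β (X ^ k * (orthoJ α β (n + i) * orthoJ α β (n + j)))) atTop
      (𝓝 (cosInt (X ^ k) ((i : ℝ) - j))) := by
  induction k generalizing i j with
  | zero =>
    simp only [pow_zero, one_mul, wInt_orthoJ_mul hα hβ, cosInt_one, Nat.add_left_cancel_iff]
    exact tendsto_const_nhds
  | succ k ih =>
    have key : ∀ i j : ℕ, Tendsto
        (fun n => wInt α β (X ^ (k + 1) * (orthoJ α β (n + i) * orthoJ α β (n + (j + 1))))) atTop
        (𝓝 (cosInt (X ^ (k + 1)) ((i : ℝ) - (j + 1 : ℕ)))) := by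
      intro i j
      have e : ∀ n, wInt α β (X ^ (k + 1) * (orthoJ α β (n + i) * orthoJ α β (n + (j + 1)))) =
          recSqrt α β (n + (j + 2)) *
              wInt α β (X ^ k * (orthoJ α β (n + i) * orthoJ α β (n + (j + 2)))) +
            recB α β (n + (j + 1)) *
              wInt α β (X ^ k * (orthoJ α β (n + i) * orthoJ α β (n + (j + 1)))) +
            recSqrt α β (n + (j + 1)) *
              wInt α β (X ^ k * (orthoJ α β (n + i) * orthoJ α β (n + j))) := by
        intro n
        rw [← wInt_C_mul, ← wInt_C_mul, ← wInt_C_mul, ← wInt_add hα hβ, ← wInt_add hα hβ]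
        apply wInt_congr
        intro x
        have := orthoJ_rec hα hβ (n + (j + 1)) x
        rw [show n + (j + 1) + 1 = n + (j + 2) by ring, show n + (j + 1) - 1 = n + j by omega]
          at this
        simp only [eval_add, eval_mul, eval_C, eval_X, eval_pow]
        linear_combination x ^ k * (orthoJ α β (n + i)).eval x * this
      simp only [e]
      have ha := fun m => (tendsto_recSqrt hα hβ).comp (tendsto_add_atTop_nat m)
      have hb := fun m => (tendsto_recB hα hβ).comp (tendsto_add_atTop_nat m)
      have := (((ha (j + 2)).mul (ih i (j + 2))).add ((hb (j + 1)).mul (ih i (j + 1)))).add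
        ((ha (j + 1)).mul (ih i j))
      have lim : cosInt (X ^ (k + 1)) ((i : ℝ) - (j + 1 : ℕ)) =
          1 / 2 * cosInt (X ^ k) ((i : ℝ) - (j + 2 : ℕ)) +
            0 * cosInt (X ^ k) ((i : ℝ) - (j + 1 : ℕ)) + 1 / 2 * cosInt (X ^ k) ((i : ℝ) - j) := by
        rw [pow_succ', cosInt_X_mul]
        push_cast
        rw [show (i : ℝ) - (j + 1) + 1 = i - j by ring,
          show (i : ℝ) - (j + 1) - 1 = i - (j + 2) by ring]
        ring
      rw [lim]
      exact this
    rcases j with _ | j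
    -- For `j = 0` the recurrence would call for the index `n - 1`; shifting `n` by one raises `i`
    -- and `j` together and leaves `i - j` unchanged.
    · have h := key (i + 1) 0
      rw [← tendsto_add_atTop_iff_nat 1]
      convert h using 2 with n
      · rw [show n + 1 + i = n + (i + 1) by ring]
      · push_cast; ring_nf
    · exact key i j

lemma tendsto_wInt_mul (hα : -1 < α) (hβ : -1 < β) (f : ℝ[X]) (i j : ℕ) :
    Tendsto (fun n => wInt α β (f * (orthoJ α β (n + i) * orthoJ α β (n + j)))) atTop
      (𝓝 (cosInt f ((i : ℝ) - j))) := by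
  induction f using Polynomial.induction_on' with
  | add p q hp hq =>
    simp only [add_mul, wInt_add hα hβ, cosInt_add]
    exact hp.add hq
  | monomial k c =>
    simp only [← C_mul_X_pow_eq_monomial, mul_assoc, wInt_C_mul, cosInt_C_mul]
    exact (tendsto_wInt_X_pow hα hβ k i j).const_mul c

lemma integral_cos_comp {f : ℝ → ℝ} (hf : Continuous f) :
    ∫ θ in (0 : ℝ)..Real.pi, f (Real.cos θ) * Real.sin θ ^ 2 =
      ∫ x in (-1 : ℝ)..1, f x * √(1 - x ^ 2) := by
  have h := intervalIntegral.integral_comp_mul_deriv (a := 0) (b := Real.pi) (f := Real.cos)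
    (f' := fun θ => -Real.sin θ) (g := fun x => f x * √(1 - x ^ 2))
    (fun x _ => Real.hasDerivAt_cos x) (by fun_prop) (by fun_prop)
  rw [Real.cos_zero, Real.cos_pi, intervalIntegral.integral_symm (-1) 1] at h
  rw [← neg_inj, ← h, ← intervalIntegral.integral_neg]
  refine intervalIntegral.integral_congr fun θ hθ => ?_
  rw [Set.uIcc_of_le Real.pi_pos.le] at hθ
  have hs := Real.sin_nonneg_of_mem_Icc hθ
  have : √(1 - Real.cos θ ^ 2) = Real.sin θ := by
    rw [← Real.sin_sq, Real.sqrt_sq hs]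
  simp only [Function.comp, this]
  ring

/-- The three terms of the form contribute `1 + 1 - 2 cos² θ = 2 sin² θ` against `dθ / π`, which
becomes the semicircle density under `x = cos θ`. -/
lemma tendsto_wInt_mul_turan (hα : -1 < α) (hβ : -1 < β) (f : ℝ[X]) :
    Tendsto (fun n => wInt α β (f * turan α β n)) atTop
      (𝓝 (2 / Real.pi * ∫ x in (-1 : ℝ)..1, f.eval x * √(1 - x ^ 2))) := by
  have e : ∀ n, wInt α β (f * turan α β n) =
      wInt α β (f * (orthoJ α β (n + 0) * orthoJ α β (n + 0))) +
        wInt α β (f * (orthoJ α β (n + 1) * orthoJ α β (n + 1))) -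
        2 * wInt α β ((X * f) * (orthoJ α β (n + 0) * orthoJ α β (n + 1))) := by
    intro n
    rw [← wInt_C_mul, ← wInt_add hα hβ, ← wInt_sub hα hβ]
    congr 1
    simp only [turan, add_zero]
    ring
  simp only [e]
  have h := (((tendsto_wInt_mul hα hβ f 0 0).add (tendsto_wInt_mul hα hβ f 1 1)).sub
    ((tendsto_wInt_mul hα hβ (X * f) 0 1).const_mul 2))
  suffices lim : 2 / Real.pi * (∫ x in (-1 : ℝ)..1, f.eval x * √(1 - x ^ 2)) =
      cosInt f ((0 : ℕ) - (0 : ℕ)) + cosInt f ((1 : ℕ) - (1 : ℕ)) -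
        2 * cosInt (X * f) ((0 : ℕ) - (1 : ℕ)) by
    rw [lim]; exact h
  rw [← integral_cos_comp f.continuous]
  unfold cosInt
  rw [show 2 / Real.pi = 1 / Real.pi * 2 by ring, mul_assoc, ← mul_add, mul_left_comm 2, ← mul_sub,
    ← intervalIntegral.integral_const_mul 2, ← intervalIntegral.integral_const_mul 2,
    ← intervalIntegral.integral_add, ← intervalIntegral.integral_sub]
  · congr 2
    ext θ
    simp [Real.sin_sq]
    ring
  all_goals exact Continuous.intervalIntegrable (by fun_prop) _ _

lemma abs_integral_mul_le {f u g : ℝ → ℝ}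
    (h : ∀ x ∈ Set.Icc (-1 : ℝ) 1, |f x * u x| ≤ g x)
    (hg : IntervalIntegrable g MeasureTheory.volume (-1) 1) :
    |∫ x in (-1 : ℝ)..1, f x * u x| ≤ ∫ x in (-1 : ℝ)..1, g x := by
  rw [← Real.norm_eq_abs]
  exact intervalIntegral.norm_integral_le_of_norm_le (by norm_num)
    (Eventually.of_forall fun x hx => h x (Set.Ioc_subset_Icc_self hx)) hg

/-- Weierstrass approximation. The measures with density `D_n w` are nonnegative and their masses
converge, so the approximation error is controlled uniformly in `n`. -/
lemma tendsto_integral_mul_turan (hα : -1 < α) (hβ : -1 < β) {f : ℝ → ℝ} (hf : Continuous f) :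
    Tendsto (fun n => ∫ x in (-1 : ℝ)..1, f x * ((turan α β n).eval x * weight α β x)) atTop
      (𝓝 (2 / Real.pi * ∫ x in (-1 : ℝ)..1, f x * √(1 - x ^ 2))) := by
  set T := 2 / Real.pi * ∫ x in (-1 : ℝ)..1, √(1 - x ^ 2) with hT
  have hsqrt : Continuous fun x : ℝ => √(1 - x ^ 2) := by fun_prop
  have hT0 : 0 ≤ T := mul_nonneg (by positivity)
    (intervalIntegral.integral_nonneg (by norm_num) fun x _ => Real.sqrt_nonneg _)
  have h1 : Tendsto (fun n => wInt α β (turan α β n)) atTop (𝓝 T) := by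
    simpa using tendsto_wInt_mul_turan hα hβ 1
  rw [Metric.tendsto_atTop']
  intro ε hε
  obtain ⟨η, hη, hηε⟩ : ∃ η > 0, η * (2 * T + 2) < ε :=
    ⟨ε / (2 * T + 3), by positivity, by
      rw [div_mul_eq_mul_div, div_lt_iff₀ (by positivity)]; nlinarith⟩
  obtain ⟨g, hg⟩ := exists_polynomial_near_of_continuousOn (-1) 1 f hf.continuousOn η hη
  have h2 := (Metric.tendsto_atTop.1 (tendsto_wInt_mul_turan hα hβ g) η hη)
  have h3 := (Metric.tendsto_atTop.1 h1 1 one_pos)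
  obtain ⟨N2, h2⟩ := h2
  obtain ⟨N3, h3⟩ := h3
  refine ⟨max N2 N3, fun n hn => ?_⟩
  have h2 := h2 n ((le_max_left _ _).trans hn.le)
  have h3 := h3 n ((le_max_right _ _).trans hn.le)
  rw [Real.dist_eq] at h2 h3 ⊢
  have hi : ∀ {f : ℝ → ℝ}, Continuous f → IntervalIntegrable
      (fun x => f x * ((turan α β n).eval x * weight α β x)) MeasureTheory.volume (-1) 1 := by
    intro f hf
    simp only [← mul_assoc]
    exact intervalIntegrable_mul_weight hα hβ (hf.mul (turan α β n).continuous)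
  have e1 : |(∫ x in (-1 : ℝ)..1, f x * ((turan α β n).eval x * weight α β x)) -
      wInt α β (g * turan α β n)| ≤ η * wInt α β (turan α β n) := by
    have : wInt α β (g * turan α β n) =
        ∫ x in (-1 : ℝ)..1, g.eval x * ((turan α β n).eval x * weight α β x) := by
      simp only [wInt, eval_mul, mul_assoc]
    rw [this, ← intervalIntegral.integral_sub (hi hf) (hi g.continuous), wInt,
      ← intervalIntegral.integral_const_mul]
    simp only [← sub_mul]
    refine abs_integral_mul_le (fun x hx => ?_)
      ((intervalIntegrable_mul_weight hα hβ (turan α β n).continuous).const_mul η)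
    have hp := mul_nonneg (turan_nonneg (α := α) (β := β) n hx) (weight_nonneg (α := α) (β := β) hx)
    rw [abs_mul, abs_of_nonneg hp, abs_sub_comm]
    exact mul_le_mul_of_nonneg_right (hg x hx).le hp
  have e2 : |2 / Real.pi * (∫ x in (-1 : ℝ)..1, g.eval x * √(1 - x ^ 2)) -
      2 / Real.pi * ∫ x in (-1 : ℝ)..1, f x * √(1 - x ^ 2)| ≤ η * T := by
    rw [← mul_sub, ← intervalIntegral.integral_sub, abs_mul,
      abs_of_pos (div_pos two_pos Real.pi_pos), hT, mul_left_comm,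
      ← intervalIntegral.integral_const_mul η]
    · refine mul_le_mul_of_nonneg_left ?_ (by positivity)
      simp only [← sub_mul]
      refine abs_integral_mul_le (fun x hx => ?_)
        (Continuous.intervalIntegrable (by fun_prop) _ _)
      rw [abs_mul, abs_of_nonneg (Real.sqrt_nonneg _)]
      exact mul_le_mul_of_nonneg_right (hg x hx).le (Real.sqrt_nonneg _)
    all_goals exact Continuous.intervalIntegrable (by fun_prop) _ _
  rw [abs_lt] at h2 h3 ⊢
  rw [abs_le] at e1 e2
  have h4 : η * wInt α β (turan α β n) ≤ η * (T + 1) :=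
    mul_le_mul_of_nonneg_left (by linarith) hη.le
  constructor <;> nlinarith

lemma abs_integral_mul_sub_le {f u : ℝ → ℝ} {c ε r : ℝ} (hf : Continuous f) (hf0 : ∀ x, 0 ≤ f x)
    (hr : ∀ x, r ≤ |x| → f x = 0)
    (hi : IntervalIntegrable (fun x => f x * u x) MeasureTheory.volume (-1) 1)
    (h : ∀ x, |x| < r → |u x - c| ≤ ε) :
    |(∫ x in (-1 : ℝ)..1, f x * u x) - c * ∫ x in (-1 : ℝ)..1, f x| ≤
      ε * ∫ x in (-1 : ℝ)..1, f x := by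
  have hc : IntervalIntegrable (fun x => f x * c) MeasureTheory.volume (-1) 1 :=
    (hf.mul continuous_const).intervalIntegrable _ _
  rw [mul_comm c, ← intervalIntegral.integral_mul_const, ← intervalIntegral.integral_sub hi hc, ← intervalIntegral.integral_const_mul]
  simp only [← mul_sub]
  refine abs_integral_mul_le (fun x _ => ?_) ((continuous_const.mul hf).intervalIntegrable _ _)
  rw [abs_mul, abs_of_nonneg (hf0 x)]
  rcases lt_or_ge |x| r with hx | hx
  · rw [mul_comm]
    exact mul_le_mul_of_nonneg_right (h x hx) (hf0 x)
  · simp [hr x hx]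

/-- The limit of the Turán determinants at the origin. -/
lemma turan_limit_eq (hα : -1 < α) (hβ : -1 < β) {L : ℝ}
    (hL : Tendsto (fun n => (turan α β n).eval 0) atTop (𝓝 L)) : L = 2 / Real.pi := by
  obtain ⟨c, hc, hcau⟩ := exists_abs_turan_sub_le hα hβ
  have hpi : 2 / Real.pi ≤ 1 := by
    rw [div_le_one Real.pi_pos]; exact Real.two_le_pi
  have hpi0 : 0 < 2 / Real.pi := by positivity
  rw [← sub_eq_zero, ← abs_eq_zero]
  refine le_antisymm (le_of_forall_pos_le_add fun ε hε => ?_) (abs_nonneg _)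
  obtain ⟨η, hη, hηε⟩ : ∃ η > 0, 5 * η = ε := ⟨ε / 5, by positivity, by ring⟩
  have t0 : Tendsto (fun n : ℕ => c / ((n : ℝ) + 1)) atTop (𝓝 0) :=
    tendsto_const_nhds.div_atTop (tendsto_atTop_add_const_right _ _ tendsto_natCast_atTop_atTop)
  obtain ⟨n0, hn0, hn0'⟩ := ((t0.eventually (gt_mem_nhds (half_pos hη))).and
    (hL.eventually (Metric.ball_mem_nhds L hη))).exists
  have hw : ContinuousAt (weight α β) 0 :=
    continuousOn_weight.continuousAt (Ioo_mem_nhds (by norm_num) (by norm_num))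
  have hw0 : weight α β 0 = 1 := by simp [weight]
  have hcont : ContinuousAt (fun x => (turan α β n0).eval x * weight α β x) 0 :=
    (turan α β n0).continuous.continuousAt.mul hw
  have hsq : ContinuousAt (fun x : ℝ => √(1 - x ^ 2)) 0 :=
    Continuous.continuousAt (by fun_prop)
  have ev : ∀ᶠ x in 𝓝 (0 : ℝ), |x| < 1 / 2 ∧ weight α β x < 2 ∧ |√(1 - x ^ 2) - 1| < η ∧
      |(turan α β n0).eval x * weight α β x - (turan α β n0).eval 0| < η := by
    have a1 : ∀ᶠ x in 𝓝 (0 : ℝ), |x| < 1 / 2 := by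
      have := Metric.ball_mem_nhds (0 : ℝ) (by norm_num : (0 : ℝ) < 1 / 2)
      filter_upwards [this] with x hx
      simpa using hx
    have a2 : ∀ᶠ x in 𝓝 (0 : ℝ), weight α β x < 2 :=
      hw.eventually (gt_mem_nhds (by rw [hw0]; norm_num))
    have a3 := hsq.eventually (Metric.ball_mem_nhds _ hη)
    have a4 := hcont.eventually (Metric.ball_mem_nhds _ hη)
    filter_upwards [a1, a2, a3, a4] with x h1 h2 h3 h4
    refine ⟨h1, h2, ?_, ?_⟩
    · simpa [Real.dist_eq] using h3
    · simpa [Real.dist_eq, hw0] using h4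
  obtain ⟨r, hr, hball⟩ := Metric.eventually_nhds_iff.1 ev
  have hball : ∀ x : ℝ, |x| < r → _ := fun x hx => hball (y := x) (by simpa using hx)
  -- A tent on which both `D_n w` and the limiting density are nearly constant; comparing its two
  -- integrals isolates `L - 2 / π`.
  set f : ℝ → ℝ := fun x => max 0 (r - |x|) with hf
  have hfc : Continuous f := by fun_prop
  have hf0 : ∀ x, 0 ≤ f x := fun x => le_max_left _ _
  have hfr : ∀ x, r ≤ |x| → f x = 0 := fun x hx => max_eq_left (by linarith)
  have hI : 0 < ∫ x in (-1 : ℝ)..1, f x := by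
    refine intervalIntegral.integral_pos (by norm_num) hfc.continuousOn (fun x _ => hf0 x)
      ⟨0, by norm_num, ?_⟩
    simp [hf, hr]
  set I := ∫ x in (-1 : ℝ)..1, f x
  have b1 : |(∫ x in (-1 : ℝ)..1, f x * √(1 - x ^ 2)) - 1 * I| ≤ η * I :=
    abs_integral_mul_sub_le hfc hf0 hfr (Continuous.intervalIntegrable (by fun_prop) _ _)
      fun x hx => (hball x hx).2.2.1.le
  -- Three errors of size `η`: from `n` to `n0` by the uniform Cauchy estimate, from `x` to `0` by
  -- continuity of `D_{n0} w`, and from `D_{n0}(0)` to `L`.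
  have b2 : ∀ n ≥ n0, |(∫ x in (-1 : ℝ)..1, f x * ((turan α β n).eval x * weight α β x)) - L * I| ≤
      3 * η * I := by
    intro n hn
    refine abs_integral_mul_sub_le hfc hf0 hfr ?_ fun x hx => ?_
    · simp only [← mul_assoc]
      exact intervalIntegrable_mul_weight hα hβ (hfc.mul (turan α β n).continuous)
    · obtain ⟨g1, g2, -, g4⟩ := hball x hx
      have g0 : 0 ≤ weight α β x :=
        weight_nonneg ⟨by linarith [(abs_lt.1 g1).1], by linarith [(abs_lt.1 g1).2]⟩
      have g5 := hcau n0 n x g1.le hn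
      have g6 : |(turan α β n).eval x * weight α β x - (turan α β n0).eval x * weight α β x| ≤ η := by
        rw [← sub_mul, abs_mul, abs_of_nonneg g0]
        calc _ ≤ (η / 2) * 2 := mul_le_mul (g5.trans hn0.le) g2.le g0 (by positivity)
          _ = η := by ring
      have g7 : |(turan α β n0).eval 0 - L| < η := by simpa [Real.dist_eq] using hn0'
      rw [abs_le] at g6 ⊢
      rw [abs_lt] at g4 g7
      constructor <;> linarith
  have b3 : |2 / Real.pi * (∫ x in (-1 : ℝ)..1, f x * √(1 - x ^ 2)) - L * I| ≤ 3 * η * I := by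
    refine le_of_tendsto (((tendsto_integral_mul_turan hα hβ hfc).sub_const _).abs) ?_
    filter_upwards [eventually_ge_atTop n0] with n hn using b2 n hn
  have b4 : |2 / Real.pi * (∫ x in (-1 : ℝ)..1, f x * √(1 - x ^ 2)) - 2 / Real.pi * I| ≤ η * I := by
    rw [← mul_sub, abs_mul, abs_of_pos hpi0]
    rw [one_mul] at b1
    calc _ ≤ 1 * (η * I) := mul_le_mul hpi b1 (abs_nonneg _) zero_le_one
      _ = η * I := one_mul _
  have b5 : |L - 2 / Real.pi| * I ≤ 4 * η * I := by
    rw [← abs_of_pos hI, ← abs_mul, abs_of_pos hI, sub_mul]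
    rw [abs_le] at b3 b4 ⊢
    constructor <;> linarith
  have := le_of_mul_le_mul_right b5 hI
  linarith

lemma exists_abs_turan_zero_sub_le (hα : -1 < α) (hβ : -1 < β) :
    ∃ c : ℝ, ∀ n : ℕ, |(turan α β n).eval 0 - 2 / Real.pi| ≤ c / ((n : ℝ) + 1) := by
  obtain ⟨L, c, hL, h⟩ := exists_tendsto_turan_zero hα hβ
  rw [turan_limit_eq hα hβ hL] at h
  exact ⟨c, h⟩

/-! ### Local behaviour at the origin -/

lemma abs_mul_add_mul_le {u v p q U V B : ℝ} (hu : |u| ≤ U) (hv : |v| ≤ V) (hp : |p| ≤ B)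
    (hq : |q| ≤ B) : |u * p + v * q| ≤ (U + V) * B := by
  have hU := (abs_nonneg u).trans hu
  have hV := (abs_nonneg v).trans hv
  calc |u * p + v * q| ≤ |u| * |p| + |v| * |q| := by
        rw [← abs_mul, ← abs_mul]; exact abs_add_le _ _
    _ ≤ U * B + V * B := by gcongr
    _ = (U + V) * B := by ring

lemma abs_le_two_mul_of_one_sub_sq_mul {x d K : ℝ} (hx : |x| ≤ 1 / 2)
    (h : |(1 - x ^ 2) * d| ≤ K) : |d| ≤ 2 * K := by
  have h1 : x ^ 2 ≤ 1 / 4 := by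
    rw [← sq_abs]; nlinarith [abs_nonneg x]
  rw [abs_mul, abs_of_pos (by linarith)] at h
  nlinarith [abs_nonneg d]

/-- The coefficient of the neighbouring polynomial in both differential relations, with `k = 3` and
`k = 1`, compared with `n (1 - x^2)`. The deviation of `recSqrt` from `1/2` survives multiplication
by `n`. -/
lemma exists_abs_coeff_sub_le (hα : -1 < α) (hβ : -1 < β) (M : ℝ) :
    ∃ W : ℝ, ∀ (n : ℕ) (x k : ℝ), 1 ≤ n → n * x ^ 2 ≤ M → 0 ≤ k → k ≤ 3 →
      |(2 * n + α + β + k) * recSqrt α β (n + 1) - n + n * x ^ 2| ≤ W := by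
  obtain ⟨A, hA0, hA⟩ := abs_recSqrt_sub_le hα hβ
  set s := |α + β| with hs
  have hs0 : 0 ≤ s := abs_nonneg _
  refine ⟨(5 + s) * A + (s + 3) + M, fun n x k hn hx hk0 hk3 => ?_⟩
  have hn1 : (1 : ℝ) ≤ n := by exact_mod_cast hn
  obtain ⟨s1, s2⟩ := abs_le.1 hs.ge
  set d := recSqrt α β (n + 1) - 1 / 2 with hd
  have ha : n * |d| ≤ A := by
    have := hA (n + 1) (by omega)
    rw [le_div_iff₀ (by positivity)] at this
    push_cast at this
    refine le_trans ?_ this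
    rw [mul_comm]
    exact mul_le_mul_of_nonneg_left (by nlinarith) (abs_nonneg _)
  have e : (2 * n + α + β + k) * recSqrt α β (n + 1) - n + n * x ^ 2 =
    (2 * n + (α + β + k)) * d + (α + β + k) / 2 + n * x ^ 2 := by rw [hd]; ring
  have f2 : |(2 * n + (α + β + k)) * d| ≤ (5 + s) * A := by
    have hsn : s + 3 ≤ (s + 3) * n := le_mul_of_one_le_right (by linarith) hn1
    have : |2 * n + (α + β + k)| ≤ (5 + s) * n := by
      rw [abs_le]
      constructor <;> linarith
    rw [abs_mul]
    calc _ ≤ (5 + s) * n * |d| := mul_le_mul_of_nonneg_right this (abs_nonneg _)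
      _ = (5 + s) * (n * |d|) := by ring
      _ ≤ _ := mul_le_mul_of_nonneg_left ha (by positivity)
  have f3 : 0 ≤ n * x ^ 2 := by positivity
  rw [e]
  rw [abs_le] at f2 ⊢
  constructor <;> linarith

lemma exists_abs_diag_coeff_le (hα : -1 < α) (hβ : -1 < β) (M : ℝ) :
    ∃ V : ℝ, ∀ (n : ℕ) (x : ℝ), 1 ≤ n → n * |x| ≤ M →
      |subCoeff α β n - n * x + (2 * n + α + β + 1) * (x - recB α β n)| ≤ V := by
  obtain ⟨R, hR0, hR⟩ := abs_recB_le hα hβ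
  obtain ⟨G, hG⟩ := abs_subCoeff_le hα hβ
  set s := |α + β| with hs
  have hs0 : 0 ≤ s := abs_nonneg _
  refine ⟨G + M + (3 + s) * (M + R), fun n x hn hM => ?_⟩
  have hn1 : (1 : ℝ) ≤ n := by exact_mod_cast hn
  obtain ⟨s1, s2⟩ := abs_le.1 hs.ge
  have hr : n * |recB α β n| ≤ R := by
    have := hR n hn
    rw [le_div_iff₀ (by positivity)] at this
    refine le_trans ?_ this
    rw [mul_comm]
    exact mul_le_mul_of_nonneg_left (by nlinarith) (abs_nonneg _)
  refine (abs_add_le _ _).trans (add_le_add ((abs_sub _ _).trans (add_le_add (hG n hn) ?_)) ?_)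
  · rwa [abs_mul, Nat.abs_cast]
  · rw [abs_mul]
    have g1 : |2 * n + α + β + 1| ≤ (3 + s) * n := by
      have hsn : s ≤ s * n := le_mul_of_one_le_right hs0 hn1
      rw [abs_le]
      constructor <;> linarith
    have g2 : n * |x - recB α β n| ≤ M + R := by
      have := mul_le_mul_of_nonneg_left (abs_sub x (recB α β n)) n.cast_nonneg (α := ℝ)
      rw [mul_add] at this
      linarith
    calc _ ≤ (3 + s) * n * |x - recB α β n| := mul_le_mul_of_nonneg_right g1 (abs_nonneg _)
      _ = (3 + s) * (n * |x - recB α β n|) := by ring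
      _ ≤ _ := mul_le_mul_of_nonneg_left g2 (by positivity)

/-- To leading order, differentiation acts as a rotation on consecutive orthonormal
polynomials near the origin. -/
lemma exists_abs_derivative_orthoJ_sub_le (hα : -1 < α) (hβ : -1 < β) (M : ℝ) :
    ∃ C : ℝ, ∀ (n : ℕ) (x : ℝ), 1 ≤ n → |x| ≤ 1 / 2 → n * |x| ≤ M →
      |(derivative (orthoJ α β (n + 1))).eval x - n * (orthoJ α β n).eval x| ≤ C ∧
      |(derivative (orthoJ α β n)).eval x + n * (orthoJ α β (n + 1)).eval x| ≤ C := by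
  obtain ⟨G, hG⟩ := abs_subCoeff_le hα hβ
  obtain ⟨B, hB0, hB⟩ := exists_abs_orthoJ_le hα hβ
  obtain ⟨W, hW⟩ := exists_abs_coeff_sub_le hα hβ M
  obtain ⟨V, hV⟩ := exists_abs_diag_coeff_le hα hβ M
  refine ⟨max (2 * ((G + 2 * M + W) * B)) (2 * ((V + W) * B)), fun n x hn hx hM => ?_⟩
  have hn1 : (1 : ℝ) ≤ n := by exact_mod_cast hn
  have hx0 := abs_nonneg x
  have hM0 : 0 ≤ M := le_trans (by positivity) hM
  have hxsq : n * x ^ 2 ≤ M := by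
    rw [← sq_abs, pow_two, ← mul_assoc]
    exact (mul_le_of_le_one_right (by positivity) (by linarith)).trans hM
  have hp0 := hB n x hx
  have hp1 := hB (n + 1) x hx
  constructor
  · refine le_trans (abs_le_two_mul_of_one_sub_sq_mul hx ?_) (le_max_left _ _)
    have e : (1 - x ^ 2) * ((derivative (orthoJ α β (n + 1))).eval x - n * (orthoJ α β n).eval x) =
      (subCoeff α β (n + 1) - (n + 1) * x) * (orthoJ α β (n + 1)).eval x +
        ((2 * n + α + β + 3) * recSqrt α β (n + 1) - n + n * x ^ 2) * (orthoJ α β n).eval x := by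
      linear_combination orthoJ_derivative_succ hα hβ n x
    rw [e]
    refine abs_mul_add_mul_le ?_ (hW n x 3 hn hxsq (by norm_num) le_rfl) hp1 hp0
    refine (abs_sub _ _).trans (add_le_add (hG _ (by omega)) ?_)
    rw [abs_mul, abs_of_nonneg (by positivity : (0 : ℝ) ≤ n + 1)]
    have : 1 * |x| ≤ n * |x| := mul_le_mul_of_nonneg_right hn1 hx0
    linarith
  · refine le_trans (abs_le_two_mul_of_one_sub_sq_mul hx ?_) (le_max_right _ _)
    have e : (1 - x ^ 2) * ((derivative (orthoJ α β n)).eval x + n * (orthoJ α β (n + 1)).eval x) =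
      (subCoeff α β n - n * x + (2 * n + α + β + 1) * (x - recB α β n)) * (orthoJ α β n).eval x +
        (-((2 * n + α + β + 1) * recSqrt α β (n + 1) - n + n * x ^ 2)) *
          (orthoJ α β (n + 1)).eval x := by
      linear_combination orthoJ_derivative hα hβ n x
    rw [e]
    exact abs_mul_add_mul_le (hV n x hn hM)
      (by rw [abs_neg]; exact hW n x 1 hn hxsq (by norm_num) (by norm_num)) hp0 hp1

/-- The Wronskian-like form of an approximate solution of the rotation system. -/
lemma abs_wronskian_sub_sin_le {y z y' z' : ℝ → ℝ} {M B ε : ℝ}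
    (hy : ∀ t, HasDerivAt y (y' t) t) (hz : ∀ t, HasDerivAt z (z' t) t)
    (hyz : ∀ t ∈ Set.Icc (-M) M, |y' t - z t| ≤ ε) (hzy : ∀ t ∈ Set.Icc (-M) M, |z' t + y t| ≤ ε)
    (hyB : ∀ t ∈ Set.Icc (-M) M, |y t| ≤ B) (hzB : ∀ t ∈ Set.Icc (-M) M, |z t| ≤ B)
    {s t : ℝ} (hs : s ∈ Set.Icc (-M) M) (ht : t ∈ Set.Icc (-M) M) :
    |y s * z t - z s * y t - (y 0 ^ 2 + z 0 ^ 2) * Real.sin (s - t)| ≤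
      (4 + 12 * M) * (B * ε) * |s - t| := by
  have hM0 : 0 ≤ M := by linarith [hs.1, hs.2]
  have h0 : (0 : ℝ) ∈ Set.Icc (-M) M := ⟨by linarith, hM0⟩
  have hB0 : 0 ≤ B := (abs_nonneg _).trans (hyB 0 h0)
  have hε0 : 0 ≤ ε := (abs_nonneg _).trans (hyz 0 h0)
  have hE : 0 ≤ B * ε := by positivity
  have pair : ∀ {p q c d : ℝ}, |p| ≤ ε → |q| ≤ ε → |c| ≤ B → |d| ≤ B → |p * c + q * d| ≤ 2 * (B * ε) := by
    intro p q c d hp hq hc hd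
    exact (abs_mul_add_mul_le hp hq hc hd).trans_eq (by ring)
  -- The squared radius is conserved by the exact rotation, hence nearly constant here.
  have hD : |(y t ^ 2 + z t ^ 2) - (y 0 ^ 2 + z 0 ^ 2)| ≤ 4 * (B * ε) * |t - 0| := by
    refine Convex.norm_image_sub_le_of_norm_hasDerivWithin_le (f := fun t => y t ^ 2 + z t ^ 2)
      (f' := fun t => 2 * ((y' t - z t) * y t + (z' t + y t) * z t))
      (fun r _ => HasDerivAt.hasDerivWithinAt ?_) (fun r hr => ?_) (convex_Icc (-M) M) h0 ht
    · refine (((hy r).pow 2).add ((hz r).pow 2)).congr_deriv ?_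
      simp only [Nat.cast_ofNat]
      ring
    · rw [Real.norm_eq_abs, abs_mul, abs_two]
      have := pair (hyz r hr) (hzy r hr) (hyB r hr) (hzB r hr)
      linarith
  have hFG : ∀ r ∈ Set.Icc (-M) M, ∀ c d : ℝ, |c| ≤ 1 → |d| ≤ 1 →
      |((y' r - z r) * z t + (z' r + y r) * (-y t)) * c +
        ((y' r - z r) * y t + (z' r + y r) * z t) * d| ≤ 4 * (B * ε) := by
    intro r hr c d hc hd
    have h1 := pair (hyz r hr) (hzy r hr) (hzB t ht) (by rw [abs_neg]; exact hyB t ht : |-y t| ≤ B)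
    have h2 := pair (hyz r hr) (hzy r hr) (hyB t ht) (hzB t ht)
    have := abs_mul_add_mul_le h1 h2 hc hd
    linarith
  -- `hU` and `hV` undo the rotation: the pair (Wronskian form, inner product), turned back by the
  -- angle `s - t`, has derivative `O(B ε)` in `s` and starts at `(0, y t ^ 2 + z t ^ 2)` when `s =
  -- t`.
  have hU : |(y s * z t - z s * y t) * Real.cos (s - t) -
      (y s * y t + z s * z t) * Real.sin (s - t) - 0| ≤ 4 * (B * ε) * |s - t| := by
    have := Convex.norm_image_sub_le_of_norm_hasDerivWithin_le
      (f := fun r => (y r * z t - z r * y t) * Real.cos (r - t) -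
        (y r * y t + z r * z t) * Real.sin (r - t))
      (f' := fun r => ((y' r - z r) * z t + (z' r + y r) * (-y t)) * Real.cos (r - t) +
        ((y' r - z r) * y t + (z' r + y r) * z t) * (-Real.sin (r - t))) (C := 4 * (B * ε))
      (fun r _ => HasDerivAt.hasDerivWithinAt ?_) (fun r hr => ?_) (convex_Icc (-M) M) ht hs
    · simpa [mul_comm] using this
    · have hc := (Real.hasDerivAt_cos (r - t)).comp r ((hasDerivAt_id r).sub_const t)
      have hsn := (Real.hasDerivAt_sin (r - t)).comp r ((hasDerivAt_id r).sub_const t)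
      refine (((((hy r).mul_const _).sub ((hz r).mul_const _)).mul hc).sub
        ((((hy r).mul_const _).add ((hz r).mul_const _)).mul hsn)).congr_deriv ?_
      simp only [Function.comp, id, Pi.sub_apply, Pi.add_apply]
      ring
    · exact hFG r hr _ _ (Real.abs_cos_le_one _) (by rw [abs_neg]; exact Real.abs_sin_le_one _)
  have hV : |(y s * z t - z s * y t) * Real.sin (s - t) +
      (y s * y t + z s * z t) * Real.cos (s - t) - (y t ^ 2 + z t ^ 2)| ≤ 4 * (B * ε) * |s - t| := by
    have := Convex.norm_image_sub_le_of_norm_hasDerivWithin_le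
      (f := fun r => (y r * z t - z r * y t) * Real.sin (r - t) +
        (y r * y t + z r * z t) * Real.cos (r - t))
      (f' := fun r => ((y' r - z r) * z t + (z' r + y r) * (-y t)) * Real.sin (r - t) +
        ((y' r - z r) * y t + (z' r + y r) * z t) * Real.cos (r - t)) (C := 4 * (B * ε))
      (fun r _ => HasDerivAt.hasDerivWithinAt ?_) (fun r hr => ?_) (convex_Icc (-M) M) ht hs
    · simpa [mul_comm, pow_two] using this
    · have hc := (Real.hasDerivAt_cos (r - t)).comp r ((hasDerivAt_id r).sub_const t)
      have hsn := (Real.hasDerivAt_sin (r - t)).comp r ((hasDerivAt_id r).sub_const t)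
      refine (((((hy r).mul_const _).sub ((hz r).mul_const _)).mul hsn).add
        ((((hy r).mul_const _).add ((hz r).mul_const _)).mul hc)).congr_deriv ?_
      simp only [Function.comp, id, Pi.sub_apply, Pi.add_apply]
      ring
    · exact hFG r hr _ _ (Real.abs_sin_le_one _) (Real.abs_cos_le_one _)
  set F := y s * z t - z s * y t
  set G := y s * y t + z s * z t
  have e : F - (y 0 ^ 2 + z 0 ^ 2) * Real.sin (s - t) =
      (F * Real.cos (s - t) - G * Real.sin (s - t) - 0) * Real.cos (s - t) +
      ((F * Real.sin (s - t) + G * Real.cos (s - t) - (y t ^ 2 + z t ^ 2)) +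
        ((y t ^ 2 + z t ^ 2) - (y 0 ^ 2 + z 0 ^ 2))) * Real.sin (s - t) := by
    linear_combination (-F) * Real.sin_sq_add_cos_sq (s - t)
  have hst : |s - t| ≤ 2 * M := by
    rw [abs_le]; constructor <;> linarith [hs.1, hs.2, ht.1, ht.2]
  have htM : |t - 0| ≤ M := by rw [sub_zero]; exact abs_le.2 ht
  -- Here `12 M = 4 · 2M + 4 · M`, from `|s - t| ≤ 2M` and `|t| ≤ M`. The missing factor `|s - t|`
  -- is supplied by the sine that multiplies this term.
  have hVD : |(F * Real.sin (s - t) + G * Real.cos (s - t) - (y t ^ 2 + z t ^ 2)) +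
        ((y t ^ 2 + z t ^ 2) - (y 0 ^ 2 + z 0 ^ 2))| ≤ 12 * M * (B * ε) := by
    refine (abs_add_le _ _).trans ?_
    have h1 := mul_le_mul_of_nonneg_left hst (by positivity : 0 ≤ 4 * (B * ε))
    have h2 := mul_le_mul_of_nonneg_left htM (by positivity : 0 ≤ 4 * (B * ε))
    linarith
  rw [e]
  refine (abs_add_le _ _).trans ?_
  rw [abs_mul, abs_mul]
  calc _ ≤ 4 * (B * ε) * |s - t| * 1 + 12 * M * (B * ε) * |s - t| :=
        add_le_add (mul_le_mul hU (Real.abs_cos_le_one _) (abs_nonneg _) (by positivity))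
          (mul_le_mul hVD Real.abs_sin_le_abs (abs_nonneg _) (by positivity))
    _ = _ := by ring

/-! ### The rescaled Christoffel–Darboux kernel -/

/-- The Christoffel–Darboux kernel of degree `n`, rescaled by `n` around the origin. -/
def scaledKernel (α β : ℝ) (n : ℕ) (x y : ℝ) : ℝ :=
  1 / (n : ℝ) * ∑ j ∈ Finset.range (n + 1), (orthoJ α β j).eval (x / n) * (orthoJ α β j).eval (y / n)

lemma sineKernel_eq_sinc (x y : ℝ) : sineKernel x y = 1 / Real.pi * Real.sinc (x - y) := by
  unfold sineKernel
  split_ifs with h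
  · simp [h]
  · have := sub_ne_zero.2 h
    rw [Real.sinc_of_ne_zero this]
    field_simp

lemma abs_sineKernel_le_one (x y : ℝ) : |sineKernel x y| ≤ 1 := by
  rw [sineKernel_eq_sinc, abs_mul, abs_of_pos (by positivity)]
  have h1 : 1 / Real.pi ≤ 1 := by
    rw [div_le_one Real.pi_pos]; linarith [Real.two_le_pi]
  calc _ ≤ (1 : ℝ) * 1 := mul_le_mul h1 (Real.abs_sinc_le_one _) (abs_nonneg _) zero_le_one
    _ = 1 := one_mul 1

lemma sub_mul_sineKernel (x y : ℝ) : (x - y) * sineKernel x y = 1 / Real.pi * Real.sin (x - y) := by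
  unfold sineKernel
  split_ifs with h
  · simp [h]
  · have := sub_ne_zero.2 h
    field_simp

lemma exists_abs_recSqrt_mul_turan_sub_le (hα : -1 < α) (hβ : -1 < β) :
    ∃ C : ℝ, ∀ n : ℕ, 1 ≤ n →
      |recSqrt α β (n + 1)| ≤ C ∧
      |recSqrt α β (n + 1) * (turan α β n).eval 0 - 1 / Real.pi| ≤ C / n := by
  obtain ⟨A, hA0, hA⟩ := abs_recSqrt_sub_le hα hβ
  obtain ⟨c, hc⟩ := exists_abs_turan_zero_sub_le hα hβ
  have hc0 : 0 ≤ c := by simpa using (abs_nonneg _).trans (hc 0)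
  refine ⟨(A + 1) * c + A + 1, fun n hn => ?_⟩
  have hn1 : (1 : ℝ) ≤ n := by exact_mod_cast hn
  have h1 : |recSqrt α β (n + 1) - 1 / 2| ≤ A / n := by
    refine (hA (n + 1) (by omega)).trans (div_le_div_of_nonneg_left hA0 (by positivity) ?_)
    push_cast
    nlinarith
  have h2 : |(turan α β n).eval 0 - 2 / Real.pi| ≤ c / n :=
    (hc n).trans (div_le_div_of_nonneg_left hc0 (by positivity) (by linarith))
  have h3 : |recSqrt α β (n + 1)| ≤ A + 1 := by
    have := h1.trans (div_le_self hA0 hn1)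
    rw [abs_le] at this ⊢
    constructor <;> linarith
  refine ⟨h3.trans (by nlinarith), ?_⟩
  have hpi : |2 / Real.pi| ≤ 1 := by
    rw [abs_of_pos (by positivity), div_le_one Real.pi_pos]; exact Real.two_le_pi
  have e : recSqrt α β (n + 1) * (turan α β n).eval 0 - 1 / Real.pi =
      recSqrt α β (n + 1) * ((turan α β n).eval 0 - 2 / Real.pi) +
        (recSqrt α β (n + 1) - 1 / 2) * (2 / Real.pi) := by ring
  rw [e]
  refine (abs_add_le _ _).trans ?_
  rw [abs_mul, abs_mul]
  calc _ ≤ (A + 1) * (c / n) + A / n * 1 := by gcongr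
    _ = ((A + 1) * c + A) / n := by ring
    _ ≤ _ := div_le_div_of_nonneg_right (by linarith) (by positivity)

lemma exists_abs_scaledKernel_sub_le_of_ne (hα : -1 < α) (hβ : -1 < β) (M : ℝ) :
    ∃ C : ℝ, ∀ n : ℕ, 1 ≤ n → 2 * M ≤ n → ∀ x ∈ Set.Icc (-M) M, ∀ y ∈ Set.Icc (-M) M, x ≠ y →
      |scaledKernel α β n x y - sineKernel x y| ≤ C / n := by
  obtain ⟨B, hB0, hB⟩ := exists_abs_orthoJ_le hα hβ
  obtain ⟨C₁, h₁⟩ := exists_abs_derivative_orthoJ_sub_le hα hβ M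
  obtain ⟨C₂, h₂⟩ := exists_abs_recSqrt_mul_turan_sub_le hα hβ
  refine ⟨C₂ * ((4 + 12 * M) * (B * C₁)) + C₂, fun n hn hnM x hx y hy hxy => ?_⟩
  have hn0 : (0 : ℝ) < n := by exact_mod_cast hn
  have hM0 : 0 ≤ M := by linarith [hx.1, hx.2]
  obtain ⟨ha, hD⟩ := h₂ n hn
  have hsmall : ∀ t ∈ Set.Icc (-M) M, |t / n| ≤ 1 / 2 ∧ n * |t / n| ≤ M := by
    intro t ht
    have ht' : |t| ≤ M := abs_le.2 ht
    rw [abs_div, Nat.abs_cast, mul_div_cancel₀ _ hn0.ne', div_le_iff₀ hn0]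
    exact ⟨by linarith, ht'⟩
  have hder : ∀ (k : ℕ) (t : ℝ), HasDerivAt (fun t : ℝ => (orthoJ α β k).eval (t / n))
      ((derivative (orthoJ α β k)).eval (t / n) * (1 / n)) t := fun k t =>
    HasDerivAt.comp (h₂ := fun x => (orthoJ α β k).eval x) (h := fun t : ℝ => t / n) t
      ((orthoJ α β k).hasDerivAt (t / n)) ((hasDerivAt_id t).div_const (n : ℝ))
  have hW := abs_wronskian_sub_sin_le (M := M) (B := B) (ε := C₁ / n) (hder (n + 1)) (hder n)
    (fun t ht => by
      obtain ⟨a1, a2⟩ := hsmall t ht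
      have := (h₁ n _ hn a1 a2).1
      rw [show eval (t / n) (derivative (orthoJ α β (n + 1))) * (1 / (n : ℝ)) -
        eval (t / n) (orthoJ α β n) = (eval (t / n) (derivative (orthoJ α β (n + 1))) -
          n * eval (t / n) (orthoJ α β n)) / n by field_simp, abs_div, Nat.abs_cast]
      exact div_le_div_of_nonneg_right this hn0.le)
    (fun t ht => by
      obtain ⟨a1, a2⟩ := hsmall t ht
      have := (h₁ n _ hn a1 a2).2
      rw [show eval (t / n) (derivative (orthoJ α β n)) * (1 / (n : ℝ)) +
        eval (t / n) (orthoJ α β (n + 1)) = (eval (t / n) (derivative (orthoJ α β n)) +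
          n * eval (t / n) (orthoJ α β (n + 1))) / n by field_simp, abs_div, Nat.abs_cast]
      exact div_le_div_of_nonneg_right this hn0.le)
    (fun t ht => hB _ _ (hsmall t ht).1) (fun t ht => hB _ _ (hsmall t ht).1) hx hy
  have hT : (orthoJ α β (n + 1)).eval (0 / (n : ℝ)) ^ 2 + (orthoJ α β n).eval (0 / (n : ℝ)) ^ 2 =
      (turan α β n).eval 0 := by
    rw [eval_turan, zero_div]; ring
  rw [hT] at hW
  have hCD := christoffel_darboux hα hβ n (x / n) (y / n)
  set a := recSqrt α β (n + 1)
  set T := (turan α β n).eval 0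
  set F := eval (x / n) (orthoJ α β (n + 1)) * eval (y / n) (orthoJ α β n) -
    eval (x / n) (orthoJ α β n) * eval (y / n) (orthoJ α β (n + 1))
  have e : (x - y) * (scaledKernel α β n x y - sineKernel x y) =
      a * (F - T * Real.sin (x - y)) + (a * T - 1 / Real.pi) * Real.sin (x - y) := by
    have : (x - y) * scaledKernel α β n x y = a * F := by
      rw [← hCD, scaledKernel]
      field_simp
    rw [mul_sub, sub_mul_sineKernel, this]
    ring
  have hpos : 0 < |x - y| := abs_pos.2 (sub_ne_zero.2 hxy)
  refine le_of_mul_le_mul_left ?_ hpos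
  rw [← abs_mul, e]
  refine (abs_add_le _ _).trans ?_
  rw [abs_mul, abs_mul]
  have hC2 : 0 ≤ C₂ := (abs_nonneg _).trans ha
  calc _ ≤ C₂ * ((4 + 12 * M) * (B * (C₁ / n)) * |x - y|) + C₂ / n * |x - y| :=
        add_le_add (mul_le_mul ha hW (abs_nonneg _) hC2)
          (mul_le_mul hD Real.abs_sin_le_abs (abs_nonneg _) (by positivity))
    _ = _ := by ring

lemma continuous_scaledKernel (n : ℕ) (x : ℝ) : Continuous (scaledKernel α β n x) := by
  unfold scaledKernel
  fun_prop

lemma continuous_sineKernel (x : ℝ) : Continuous (sineKernel x) := by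
  have : sineKernel x = fun y => 1 / Real.pi * Real.sinc (x - y) :=
    funext fun y => sineKernel_eq_sinc x y
  rw [this]
  exact continuous_const.mul (Real.continuous_sinc.comp (by fun_prop))

/-- The off-diagonal bound is uniform and both kernels are continuous, so it extends to `x = y`. It
is invoked with `M + 1` to leave room for points approaching an endpoint. -/
lemma exists_abs_scaledKernel_sub_le (hα : -1 < α) (hβ : -1 < β) (M : ℝ) :
    ∃ C : ℝ, ∀ n : ℕ, 1 ≤ n → 2 * (M + 1) ≤ n →
      ∀ x ∈ Set.Icc (-M) M, ∀ y ∈ Set.Icc (-M) M,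
        |scaledKernel α β n x y - sineKernel x y| ≤ C / n := by
  obtain ⟨C, hC⟩ := exists_abs_scaledKernel_sub_le_of_ne hα hβ (M + 1)
  refine ⟨C, fun n hn hnM x hx y hy => ?_⟩
  have hx' : x ∈ Set.Icc (-(M + 1)) (M + 1) := ⟨by linarith [hx.1], by linarith [hx.2]⟩
  have hlim : Tendsto (fun z => |scaledKernel α β n x z - sineKernel x z|) (𝓝[≠] y)
      (𝓝 |scaledKernel α β n x y - sineKernel x y|) :=
    (((continuous_scaledKernel n x).sub (continuous_sineKernel x)).abs.tendsto y).mono_left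
      nhdsWithin_le_nhds
  by_cases hxy : x = y
  · subst hxy
    refine le_of_tendsto hlim ?_
    have hnear : ∀ᶠ z in 𝓝[≠] x, z ∈ Set.Icc (-(M + 1)) (M + 1) :=
      nhdsWithin_le_nhds (Icc_mem_nhds (by linarith [hx.1]) (by linarith [hx.2]))
    filter_upwards [hnear, self_mem_nhdsWithin] with z hz hzx
    exact hC n hn hnM x hx' z hz (Ne.symm hzx)
  · exact hC n hn hnM x hx' y ⟨by linarith [hy.1], by linarith [hy.2]⟩ hxy

/-! ### Conclusion -/

/-- The normalization of `jacobiP` enters squared both in the product and in `jacobiH`, so it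
cancels together with its sign. -/
lemma phi4_mul_phi4 {a b : ℝ} (ha : 0 < a) (hb : 0 < b) (j : ℕ) (x y : ℝ) :
    phi4 a b j x * phi4 a b j y =
      ((1 - x) ^ (a / 2 - 1) * (1 + x) ^ (b / 2 - 1)) *
        ((1 - y) ^ (a / 2 - 1) * (1 + y) ^ (b / 2 - 1)) *
        ((orthoJ (a - 1) (b - 1) j).eval x * (orthoJ (a - 1) (b - 1) j).eval y) := by
  have hα : -1 < a - 1 := by linarith
  have hβ : -1 < b - 1 := by linarith
  obtain ⟨c, hc, hP⟩ := jacobiP_eq hα hβ j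
  have hN := normSq_pos hα hβ j
  have hH : jacobiH (a - 1) (b - 1) j = c ^ 2 * normSq (a - 1) (b - 1) j := by
    rw [jacobiH_eq, hP, mul_mul_mul_comm, ← C_mul, wInt_C_mul, normSq]
    ring
  have key : (jacobiP (a - 1) (b - 1) j).eval x / √(jacobiH (a - 1) (b - 1) j) *
      ((jacobiP (a - 1) (b - 1) j).eval y / √(jacobiH (a - 1) (b - 1) j)) =
      (orthoJ (a - 1) (b - 1) j).eval x * (orthoJ (a - 1) (b - 1) j).eval y := by
    rw [div_mul_div_comm, Real.mul_self_sqrt (by rw [hH]; positivity), hH, hP]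
    simp only [eval_mul, eval_C]
    rw [eval_monicJ hα hβ, eval_monicJ hα hβ]
    have h2 := Real.sq_sqrt hN.le
    field_simp
    rw [h2]
    ring
  rw [← key]
  unfold phi4
  ring

/-- The function is differentiable at `0` with value `1`. The exponent `k` is `1` for the variable
`x` and `0` for `y`, since `S4` carries `1 - x^2` in its first variable only. -/
lemma exists_abs_prefactor_sub_one_le (p q : ℝ) (k : ℕ) :
    ∃ C : ℝ, ∀ᶠ x in 𝓝 (0 : ℝ),
      |(1 - x ^ 2) ^ k * ((1 - x) ^ p * (1 + x) ^ q) - 1| ≤ C * |x| := by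
  have hd : DifferentiableAt ℝ (fun x : ℝ => (1 - x ^ 2) ^ k * ((1 - x) ^ p * (1 + x) ^ q)) 0 := by
    refine DifferentiableAt.mul (by fun_prop) (DifferentiableAt.mul ?_ ?_)
    · exact DifferentiableAt.rpow_const (by fun_prop) (Or.inl (by norm_num))
    · exact DifferentiableAt.rpow_const (by fun_prop) (Or.inl (by norm_num))
  obtain ⟨C, hC⟩ := hd.isBigO_sub.bound
  refine ⟨C, ?_⟩
  filter_upwards [hC] with x hx
  simpa using hx

lemma abs_mul_mul_sub_le {u v K S U V E : ℝ} (hu : |u - 1| ≤ U) (hv : |v - 1| ≤ V) (hU : U ≤ 1)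
    (hS : |S| ≤ 1) (hK : |K - S| ≤ E) : |u * v * K - S| ≤ (2 * V + U) * (1 + E) + E := by
  have hu2 : |u| ≤ 2 := by
    rw [abs_le] at hu ⊢; constructor <;> linarith
  have hK2 : |K| ≤ 1 + E := by
    rw [abs_le] at hS hK ⊢; constructor <;> linarith
  have hV0 := (abs_nonneg _).trans hv
  have hU0 := (abs_nonneg _).trans hu
  have h1 : |u * v - 1| ≤ 2 * V + U := by
    rw [show u * v - 1 = u * (v - 1) + (u - 1) by ring]
    refine (abs_add_le _ _).trans (add_le_add ?_ hu)
    rw [abs_mul]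
    exact mul_le_mul hu2 hv (abs_nonneg _) zero_le_two
  rw [show u * v * K - S = (u * v - 1) * K + (K - S) by ring]
  refine (abs_add_le _ _).trans (add_le_add ?_ hK)
  rw [abs_mul]
  exact mul_le_mul h1 hK2 (abs_nonneg _) (by positivity)

lemma S4_eq {a b : ℝ} (ha : 0 < a) (hb : 0 < b) (N : ℕ) (x y : ℝ) :
    1 / (2 * (N : ℝ)) * S4 a b N (x / (2 * (N : ℝ))) (y / (2 * (N : ℝ))) =
      ((1 - (x / (2 * (N : ℝ))) ^ 2) ^ 1 *
        ((1 - x / (2 * (N : ℝ))) ^ (a / 2 - 1) * (1 + x / (2 * (N : ℝ))) ^ (b / 2 - 1))) *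
      ((1 - (y / (2 * (N : ℝ))) ^ 2) ^ 0 *
        ((1 - y / (2 * (N : ℝ))) ^ (a / 2 - 1) * (1 + y / (2 * (N : ℝ))) ^ (b / 2 - 1))) *
      scaledKernel (a - 1) (b - 1) (2 * N) x y := by
  unfold S4 scaledKernel
  simp only [mul_assoc (1 - (x / (2 * (N : ℝ))) ^ 2), phi4_mul_phi4 ha hb]
  rw [← Finset.mul_sum, ← Finset.mul_sum]
  push_cast
  ring

end JSE

end

theorem mainTheorem7 (a b : ℝ) (ha : 0 < a) (hb : 0 < b) (K : Set ℝ) (hK : IsCompact K) :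
    ∃ C : ℝ, ∀ᶠ N : ℕ in Filter.atTop, ∀ x ∈ K, ∀ y ∈ K,
      |1 / (2 * (N : ℝ)) * JSE.S4 a b N (x / (2 * (N : ℝ))) (y / (2 * (N : ℝ)))
        - JSE.sineKernel x y| ≤ C / (N : ℝ) := by
  have hα : -1 < a - 1 := by linarith
  have hβ : -1 < b - 1 := by linarith
  obtain ⟨M, hM⟩ := hK.isBounded.exists_norm_le
  have hKM : ∀ x ∈ K, |x| ≤ |M| := fun x hx => (hM x hx).trans (le_abs_self M)
  obtain ⟨C, hC⟩ := JSE.exists_abs_scaledKernel_sub_le hα hβ |M|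
  obtain ⟨U, hU⟩ := JSE.exists_abs_prefactor_sub_one_le (a / 2 - 1) (b / 2 - 1) 1
  obtain ⟨V, hV⟩ := JSE.exists_abs_prefactor_sub_one_le (a / 2 - 1) (b / 2 - 1) 0
  obtain ⟨r, hr, hUV⟩ := Metric.eventually_nhds_iff.1 (hU.and hV)
  refine ⟨(2 * |V| * |M| + |U| * |M|) * (1 + |C|) + |C|, ?_⟩
  -- The thresholds in turn give `N ≥ 1`, the condition `2 (|M| + 1) ≤ 2N` of the kernel estimate,
  -- rescaled points inside the ball of radius `r`, and a prefactor error in `x` of at most `1`.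
  filter_upwards [Filter.eventually_ge_atTop 1,
    tendsto_natCast_atTop_atTop.eventually_ge_atTop (|M| + 1),
    tendsto_natCast_atTop_atTop.eventually_gt_atTop (|M| / r),
    tendsto_natCast_atTop_atTop.eventually_ge_atTop (|U| * |M|)] with N h1 h2 h3 h4 x hx y hy
  have hN1 : (1 : ℝ) ≤ N := by exact_mod_cast h1
  have hN0 : (0 : ℝ) < N := by linarith
  have hsmall : ∀ x ∈ K, |x / (2 * (N : ℝ))| ≤ |M| / N ∧ |x / (2 * (N : ℝ))| < r := by
    intro x hx
    have h : |x / (2 * (N : ℝ))| ≤ |M| / N := by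
      rw [abs_div, abs_of_pos (by positivity : (0 : ℝ) < 2 * N)]
      exact div_le_div₀ (abs_nonneg _) (hKM x hx) hN0 (by linarith)
    refine ⟨h, h.trans_lt ?_⟩
    rw [div_lt_iff₀ hr] at h3
    rw [div_lt_iff₀ hN0]
    linarith
  obtain ⟨x1, x2⟩ := hsmall x hx
  obtain ⟨y1, y2⟩ := hsmall y hy
  have bound : ∀ {W t : ℝ}, |t| ≤ |M| / N → W * |t| ≤ |W| * |M| / N := by
    intro W t ht
    rw [mul_div_assoc]
    exact mul_le_mul (le_abs_self W) ht (abs_nonneg _) (abs_nonneg _)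
  have hu := (hUV (y := x / (2 * (N : ℝ))) (by rwa [Real.dist_0_eq_abs])).1.trans (bound x1)
  have hv := (hUV (y := y / (2 * (N : ℝ))) (by rwa [Real.dist_0_eq_abs])).2.trans (bound y1)
  have hk := hC (2 * N) (by omega) (by push_cast; linarith) x (abs_le.1 (hKM x hx)) y
    (abs_le.1 (hKM y hy))
  have hk' : |JSE.scaledKernel (a - 1) (b - 1) (2 * N) x y - JSE.sineKernel x y| ≤ |C| / N := by
    refine hk.trans (div_le_div₀ (abs_nonneg _) (le_abs_self C) hN0 ?_)
    push_cast
    linarith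
  rw [JSE.S4_eq ha hb]
  refine (JSE.abs_mul_mul_sub_le hu hv ((div_le_one hN0).2 h4) (JSE.abs_sineKernel_le_one x y)
    hk').trans ?_
  have hCN : |C| / N ≤ |C| := div_le_self (abs_nonneg _) hN1
  calc _ ≤ (2 * (|V| * |M| / N) + |U| * |M| / N) * (1 + |C|) + |C| / N := by gcongr
    _ = _ := by ring
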